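/- Let $X$ be a Banach space and $1<p<\infty$. For $f\in L^p(\partial\mathbb D;X)$ let $\mathcal H f$ denote its Hilbert transform (conjugate function): if $f$ has Fourier series $a_0+\sum_{n\ge1}(a_n\cos n\theta+b_n\sin n\theta)$ with $a_n,b_n\in X$, then $\mathcal H f$ is the function with Fourier series $\sum_{n\ge1}(a_n\sin n\theta-b_n\cos n\theta)$. For a dyadic interval $I\subset[0,1)$ let $I_-$ and $I_+$ be its left and right halves and $h_I=|I|^{-1/2}(\mathbf 1_{I_+}-\mathbf 1_{I_-})$ its Haar function. The dyadic Hilbert transform is the operator $$\mathcal S f=\sum_{I}\Big(\big(f,h_{I_+}\big)\,h_{I_-}-\big(f,h_{I_-}\big)\,h_{I_+}\Big),\qquad f\in L^p([0,1);X),$$ where $I$ runs through the dyadic subintervals of $[0,1)$, including $[0,1)$ itself, the coefficients are $(f,h)=\int_0^1 f(x)h(x)\,dx$, and the partial sums over the generations converge in $L^p$; that is, $\mathcal S$ sends the constants and $h_{[0,1)}$ to $0$, and $h_{I_\pm}$ to $\pm h_{I_\mp}$. Let $\|\cdot\|_{p\to p}$ denote the operator norm on $L^p$, equal to $\infty$ if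 the operator is not defined and bounded on all of $L^p$. Then $$\|\mathcal H\|_{p\to p}\le\|\mathcal S\|_{p\to p}.$$ In particular, if $\mathcal S$ is bounded on $L^p([0,1);X)$, then $\mathcal H$ is bounded on $L^p(\partial\mathbb D;X)$. -/

import Mathlib

open MeasureTheory Filter Topology
open scoped NNReal ENNReal

noncomputable section

/-- The operator norm on `L^p(μ; X)` of an operator `T` given through its graph `R`, where `R f g`
says that `f` lies in the domain of `T` and that `T f = g` (almost everywhere): the least `C` such
that every `f ∈ L^p` has an image `g ∈ L^p` with `‖g‖_p ≤ C ‖f‖_p`. It is `∞` if `T` is not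
an everywhere defined bounded operator on `L^p`. -/
def lpOperatorNorm {α X : Type*} [MeasurableSpace α] [NormedAddCommGroup X]
    (μ : Measure α) (p : ℝ≥0∞) (R : (α → X) → (α → X) → Prop) : ℝ≥0∞ :=
  ⨅ (C : ℝ≥0) (_ : ∀ f : α → X, MemLp f p μ →
      ∃ g : α → X, MemLp g p μ ∧ R f g ∧ eLpNorm g p μ ≤ C * eLpNorm f p μ), (C : ℝ≥0∞)

/-! ### The Hilbert transform (conjugate function) on the circle -/

instance factTwoPiPos : Fact (0 < 2 * Real.pi) := ⟨Real.two_pi_pos⟩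

/-- `g` is the Hilbert transform (conjugate function) of `f` on the circle `ℝ / 2πℤ`, which carries
arc length. The Fourier
series of `g` is the series conjugate to that of `f`: constants go to `0`, `cos (n θ)` goes to
`sin (n θ)` and `sin (n θ)` goes to `- cos (n θ)` for `n ≥ 1`. Here
`(fourier n θ).re = cos (n θ)` and `(fourier n θ).im = sin (n θ)`. -/
def IsHilbertTransform {X : Type*} [NormedAddCommGroup X] [NormedSpace ℝ X]
    (f g : AddCircle (2 * Real.pi) → X) : Prop :=
  (∫ θ, g θ) = 0 ∧
  ∀ n : ℕ, 1 ≤ n →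
    (∫ θ, (fourier (n : ℤ) θ).re • g θ) = - ∫ θ, (fourier (n : ℤ) θ).im • f θ ∧
    (∫ θ, (fourier (n : ℤ) θ).im • g θ) = ∫ θ, (fourier (n : ℤ) θ).re • f θ

/-- The operator norm of the Hilbert transform on `L^p(∂𝔻; X)`. -/
def hilbertNorm (X : Type*) [NormedAddCommGroup X] [NormedSpace ℝ X] (p : ℝ≥0∞) : ℝ≥0∞ :=
  lpOperatorNorm (X := X) (volume : Measure (AddCircle (2 * Real.pi))) p IsHilbertTransform

/-! ### The dyadic Hilbert transform on `[0, 1)` -/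

/-- Lebesgue measure on `[0, 1)`. -/
def unitMeasure : Measure ℝ := volume.restrict (Set.Ico 0 1)

/-- The dyadic interval `[m 2⁻ᵏ, (m + 1) 2⁻ᵏ)`, with left child `dyadicInterval (k + 1) (2 * m)`
and right child `dyadicInterval (k + 1) (2 * m + 1)`. -/
def dyadicInterval (k m : ℕ) : Set ℝ :=
  Set.Ico ((m : ℝ) / 2 ^ k) (((m : ℝ) + 1) / 2 ^ k)

/-- The `L²`-normalized Haar function `h_I = |I|^(-1/2) (1_{I₊} - 1_{I₋})` of the dyadic interval
`I = dyadicInterval k m`, where `I₋` is the left and `I₊` the right child of `I`. -/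
def haarFun (k m : ℕ) (x : ℝ) : ℝ :=
  √(2 ^ k) * ((dyadicInterval (k + 1) (2 * m + 1)).indicator 1 x
    - (dyadicInterval (k + 1) (2 * m)).indicator 1 x)

/-- The Haar coefficient `(f, h_I)` of `f`, for `I = dyadicInterval k m`. -/
def haarCoeff {X : Type*} [NormedAddCommGroup X] [NormedSpace ℝ X]
    (f : ℝ → X) (k m : ℕ) : X :=
  ∫ x, haarFun k m x • f x ∂unitMeasure

/-- The image, under `h_{I₊} ↦ h_{I₋}`, `h_{I₋} ↦ - h_{I₊}`, of the part of the Haar expansion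
of `f` that belongs to the children of the dyadic intervals `I` of the generations `0, …, n - 1`.
The mean value of `f` and its component along `h_{[0,1)}` go to `0`. -/
def dyadicHilbertPartial {X : Type*} [NormedAddCommGroup X] [NormedSpace ℝ X]
    (n : ℕ) (f : ℝ → X) (x : ℝ) : X :=
  ∑ k ∈ Finset.range n, ∑ m ∈ Finset.range (2 ^ k),
    (haarFun (k + 1) (2 * m) x • haarCoeff f (k + 1) (2 * m + 1)
      - haarFun (k + 1) (2 * m + 1) x • haarCoeff f (k + 1) (2 * m))

/-- `g` is the dyadic Hilbert transform of `f`: the Haar series of `f`, transformed term by term,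
converges to `g` in `L^p([0, 1); X)`. -/
def IsDyadicHilbertTransform {X : Type*} [NormedAddCommGroup X] [NormedSpace ℝ X]
    (p : ℝ≥0∞) (f g : ℝ → X) : Prop :=
  Tendsto (fun n => eLpNorm (fun x => g x - dyadicHilbertPartial n f x) p unitMeasure)
    atTop (𝓝 0)

/-- The operator norm of the dyadic Hilbert transform on `L^p([0, 1); X)`. -/
def dyadicHilbertNorm (X : Type*) [NormedAddCommGroup X] [NormedSpace ℝ X]
    (p : ℝ≥0∞) : ℝ≥0∞ :=
  lpOperatorNorm (X := X) unitMeasure p (IsDyadicHilbertTransform p)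

end

/-! On boundary values of analytic functions vanishing at `0` the conjugate function is
multiplication by `-i`. The proof realises such functions by dyadic martingales on which `𝒮` is also
multiplication by `-i`. A random walk in the disc starts at `0` and uses two binary digits per step:
on an interval `I` of even generation it moves by `±iδ` on `I₋` and by `±δ` on `I₊`. For each `n` a
martingale with increments `n z ^ (n - 1) dz` accompanies `z ^ n`; its increment over `I` is a
multiple of `h_{I₊} + i h_{I₋}`, up to normalisation. Since `𝒮` sends this to `h_{I₋} - i h_{I₊}`,
it multiplies the martingale, less its mean, by `-i` exactly (`dyadicHilbertPartial_walk_snd`). Real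
parts and coefficients in `X` commute with `𝒮`.

The martingale differs from `z ^ n` only by an accumulated Taylor error. The second order terms
carry the factor `(±δ)² = δ²` or `(±iδ)² = -δ²` with equal probability, so they cancel in mean. With
`δ = (m+1)⁻²` and `(m+1)⁵` steps, exponential moments show that the error tends to `0` in every
`L^p`, `p < ∞` (`tendsto_eLpNorm_diskWalk_sub`). Meanwhile `Nδ² → ∞`, so the walk reaches the
circle; as the means of `z ^ n` converge to `0 ^ n`, its end point becomes equidistributed there
(`isWalkAverage_of_continuous`).

Hence the `L^p` norms of a trigonometric polynomial and of its conjugate are limits of norms of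
pairs related by `𝒮`, and any bound for `𝒮` passes to them with the same constant
(`IsModelled.eLpNorm_le`). Density and completeness give all of `L^p`. -/

instance : IsProbabilityMeasure unitMeasure := ⟨by simp [unitMeasure]⟩

/-- The function on `[0, 1)` that is a scaled copy of `f` on the left half and a scaled copy of `g`
on the right half. -/
noncomputable def bisect {β : Type*} (f g : SimpleFunc ℝ β) : SimpleFunc ℝ β :=
  SimpleFunc.piecewise (Set.Iio (1 / 2)) measurableSet_Iio
    (f.comp (fun x => 2 * x) (by fun_prop)) (g.comp (fun x => 2 * x - 1) (by fun_prop))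

theorem bisect_apply {β : Type*} (f g : SimpleFunc ℝ β) (x : ℝ) :
    bisect f g x = if x < 1 / 2 then f (2 * x) else g (2 * x - 1) := by
  simp [bisect, SimpleFunc.piecewise_apply]

theorem map_bisect {β γ : Type*} (φ : β → γ) (f g : SimpleFunc ℝ β) :
    (bisect f g).map φ = bisect (f.map φ) (g.map φ) := by
  ext x
  simp only [SimpleFunc.map_apply, bisect_apply]
  split_ifs <;> rfl

/-! ### Self-similarity of Haar coefficients and of the dyadic Hilbert transform -/

section Dyadic

theorem integrable_simpleFunc_unitMeasure {X : Type*} [NormedAddCommGroup X] (f : SimpleFunc ℝ X) : Integrable f unitMeasure :=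
  SimpleFunc.integrable_of_isFiniteMeasure f

variable {X : Type*} [NormedAddCommGroup X] [NormedSpace ℝ X]

/-- Change of variables on each half. General integrable functions are needed because the integrands
below are products with Haar functions. -/
theorem integral_halves {f g : ℝ → X} (hf : Integrable f unitMeasure)
    (hg : Integrable g unitMeasure) :
    ∫ x, (if x < 1 / 2 then f (2 * x) else g (2 * x - 1)) ∂unitMeasure
      = (1 / 2 : ℝ) • (∫ x, f x ∂unitMeasure + ∫ x, g x ∂unitMeasure) := by
  have hm : MeasurableSet (Set.Ico (0 : ℝ) 1) := measurableSet_Ico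
  rw [unitMeasure] at *
  have hf' := (integrable_indicator_iff hm).2 hf
  have hg' := (integrable_indicator_iff hm).2 hg
  -- At every `x` at most one of the two rescaled indicators is nonzero.
  have key : (Set.Ico (0 : ℝ) 1).indicator
        (fun x => if x < 1 / 2 then f (2 * x) else g (2 * x - 1))
      = fun x => (Set.Ico (0 : ℝ) 1).indicator f (2 * x)
        + (Set.Ico (0 : ℝ) 1).indicator g (2 * x - 1) := by
    funext x
    simp only [Set.indicator_apply, Set.mem_Ico]
    split_ifs <;> first | (simp; done) | (exfalso; grind)
  have hg2 : Integrable (fun x => (Set.Ico (0 : ℝ) 1).indicator g (2 * x - 1)) :=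
    (hg'.comp_sub_right 1).comp_mul_left' two_ne_zero
  rw [← integral_indicator hm, ← integral_indicator hm, ← integral_indicator hm, key,
    integral_add (hf'.comp_mul_left' two_ne_zero) hg2,
    Measure.integral_comp_mul_left (fun x => (Set.Ico (0 : ℝ) 1).indicator f x),
    Measure.integral_comp_mul_left (fun x => (Set.Ico (0 : ℝ) 1).indicator g (x - 1)),
    integral_sub_right_eq_self (fun x => (Set.Ico (0 : ℝ) 1).indicator g x), smul_add]
  norm_num

theorem integral_bisect (f g : SimpleFunc ℝ X) :
    ∫ x, bisect f g x ∂unitMeasure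
      = (1 / 2 : ℝ) • (∫ x, f x ∂unitMeasure + ∫ x, g x ∂unitMeasure) := by
  simp only [bisect_apply]
  exact integral_halves (integrable_simpleFunc_unitMeasure f) (integrable_simpleFunc_unitMeasure g)

theorem mem_dyadicInterval_succ (k m : ℕ) (x : ℝ) :
    x ∈ dyadicInterval (k + 1) m ↔ 2 * x ∈ dyadicInterval k m := by
  have : (0 : ℝ) < 2 ^ k := by positivity
  simp only [dyadicInterval, Set.mem_Ico, pow_succ]
  rw [div_le_iff₀ (by positivity), lt_div_iff₀ (by positivity), div_le_iff₀ this, lt_div_iff₀ this]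
  constructor <;> rintro ⟨h1, h2⟩ <;> constructor <;> linarith

theorem mem_dyadicInterval_succ_add (k m : ℕ) (x : ℝ) :
    x ∈ dyadicInterval (k + 1) (2 ^ k + m) ↔ 2 * x - 1 ∈ dyadicInterval k m := by
  have : (0 : ℝ) < 2 ^ k := by positivity
  simp only [dyadicInterval, Set.mem_Ico, pow_succ]
  rw [div_le_iff₀ (by positivity), lt_div_iff₀ (by positivity), div_le_iff₀ this, lt_div_iff₀ this]
  push_cast
  constructor <;> rintro ⟨h1, h2⟩ <;> constructor <;> linarith

theorem dyadicInterval_subset {k m : ℕ} (hm : m < 2 ^ k) :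
    dyadicInterval k m ⊆ Set.Ico 0 1 := by
  have : (0 : ℝ) < 2 ^ k := by positivity
  have hm' : (m : ℝ) + 1 ≤ 2 ^ k := by exact_mod_cast hm
  exact Set.Ico_subset_Ico (by positivity) ((div_le_one this).2 hm')

theorem indicator_one_congr {S T : Set ℝ} {x y : ℝ} (h : x ∈ S ↔ y ∈ T) :
    S.indicator (1 : ℝ → ℝ) x = T.indicator 1 y := by
  by_cases hx : x ∈ S
  · simp [hx, h.1 hx]
  · simp [hx, mt h.2 hx]

theorem haarFun_succ (k m : ℕ) (x : ℝ) : haarFun (k + 1) m x = √2 * haarFun k m (2 * x) := by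
  rw [haarFun, haarFun, indicator_one_congr (mem_dyadicInterval_succ (k + 1) _ x),
    indicator_one_congr (mem_dyadicInterval_succ (k + 1) _ x), pow_succ, Real.sqrt_mul (by positivity)]
  ring

theorem haarFun_succ_add (k m : ℕ) (x : ℝ) :
    haarFun (k + 1) (2 ^ k + m) x = √2 * haarFun k m (2 * x - 1) := by
  have h1 : 2 * (2 ^ k + m) + 1 = 2 ^ (k + 1) + (2 * m + 1) := by ring
  have h2 : 2 * (2 ^ k + m) = 2 ^ (k + 1) + 2 * m := by ring
  rw [haarFun, haarFun, h1, h2, indicator_one_congr (mem_dyadicInterval_succ_add (k + 1) _ x),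
    indicator_one_congr (mem_dyadicInterval_succ_add (k + 1) _ x), pow_succ _ k, Real.sqrt_mul (by positivity)]
  ring

theorem haarFun_eq_zero {k m : ℕ} (hm : m < 2 ^ k) {x : ℝ} (hx : x ∉ Set.Ico (0 : ℝ) 1) :
    haarFun k m x = 0 := by
  have h1 : x ∉ dyadicInterval (k + 1) (2 * m + 1) := fun h =>
    hx (dyadicInterval_subset (by rw [pow_succ]; omega) h)
  have h2 : x ∉ dyadicInterval (k + 1) (2 * m) := fun h =>
    hx (dyadicInterval_subset (by rw [pow_succ]; omega) h)
  simp [haarFun, h1, h2]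

theorem haarFun_zero_zero {x : ℝ} (hx : x ∈ Set.Ico (0 : ℝ) 1) :
    haarFun 0 0 x = if x < 1 / 2 then -1 else 1 := by
  obtain ⟨h0, h1⟩ := hx
  simp only [haarFun, dyadicInterval, Set.indicator_apply, Set.mem_Ico]
  norm_num
  split_ifs <;> first | (norm_num; done) | (exfalso; grind)

theorem measurable_haarFun (k m : ℕ) : Measurable (haarFun k m) := by
  unfold haarFun
  exact measurable_const.mul ((measurable_one.indicator measurableSet_Ico).sub
    (measurable_one.indicator measurableSet_Ico))

theorem abs_haarFun_le (k m : ℕ) (x : ℝ) : |haarFun k m x| ≤ √(2 ^ k) := by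
  rw [haarFun, abs_mul, abs_of_nonneg (Real.sqrt_nonneg _)]
  refine mul_le_of_le_one_right (Real.sqrt_nonneg _) ?_
  by_cases h1 : x ∈ dyadicInterval (k + 1) (2 * m + 1) <;>
    by_cases h2 : x ∈ dyadicInterval (k + 1) (2 * m) <;> simp [h1, h2]

theorem integrable_haarFun_smul {f : ℝ → X} (hf : Integrable f unitMeasure) (k m : ℕ) :
    Integrable (fun x => haarFun k m x • f x) unitMeasure :=
  hf.bdd_smul (√(2 ^ k)) (measurable_haarFun k m).aestronglyMeasurable
    (ae_of_all _ fun x => abs_haarFun_le k m x)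

theorem haarCoeff_add_smul {f g : ℝ → X} (hf : Integrable f unitMeasure)
    (hg : Integrable g unitMeasure) (c : ℝ) (k m : ℕ) :
    haarCoeff (fun x => f x + c • g x) k m = haarCoeff f k m + c • haarCoeff g k m := by
  simp only [haarCoeff, smul_add]
  rw [integral_add (integrable_haarFun_smul hf k m) (integrable_haarFun_smul (f := fun x => c • g x) (hg.smul c) k m),
    ← integral_smul]
  simp only [smul_comm c]

theorem dyadicHilbertPartial_add_smul {f g : ℝ → X} (hf : Integrable f unitMeasure)
    (hg : Integrable g unitMeasure) (c : ℝ) (n : ℕ) (x : ℝ) :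
    dyadicHilbertPartial n (fun x => f x + c • g x) x
      = dyadicHilbertPartial n f x + c • dyadicHilbertPartial n g x := by
  simp only [dyadicHilbertPartial, haarCoeff_add_smul hf hg, Finset.smul_sum,
    ← Finset.sum_add_distrib]
  refine Finset.sum_congr rfl fun k _ => Finset.sum_congr rfl fun m _ => ?_
  simp only [smul_add, smul_sub, smul_comm c]
  abel

/-- The normalisation of the Haar function contributes `√2` and the change of variables `1/2`. -/
theorem haarCoeff_bisect_left (f g : SimpleFunc ℝ X) {k m : ℕ} (hm : m < 2 ^ k) :
    haarCoeff (bisect f g) (k + 1) m = (√2)⁻¹ • haarCoeff f k m := by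
  have h : ∀ x, haarFun (k + 1) m x • bisect f g x
      = if x < 1 / 2 then √2 • haarFun k m (2 * x) • f (2 * x) else (0 : X) := by
    intro x
    rw [haarFun_succ, bisect_apply, mul_smul]
    split_ifs with hx
    · rfl
    · rw [haarFun_eq_zero hm (fun h => by have := h.2; linarith), zero_smul, smul_zero]
  simp only [haarCoeff, h]
  rw [integral_halves (f := fun y => √2 • haarFun k m y • f y) (g := fun _ => 0)
    ((integrable_haarFun_smul (integrable_simpleFunc_unitMeasure f) k m).smul _)
    (integrable_zero _ _ _), integral_smul]
  simp only [integral_zero, add_zero, smul_smul]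
  congr 1
  have := Real.sq_sqrt (show (0 : ℝ) ≤ 2 by norm_num)
  field_simp
  linarith

theorem haarCoeff_bisect_right (f g : SimpleFunc ℝ X) {k m : ℕ} (hm : m < 2 ^ k) :
    haarCoeff (bisect f g) (k + 1) (2 ^ k + m) = (√2)⁻¹ • haarCoeff g k m := by
  have h : ∀ x, haarFun (k + 1) (2 ^ k + m) x • bisect f g x
      = if x < 1 / 2 then (0 : X) else √2 • haarFun k m (2 * x - 1) • g (2 * x - 1) := by
    intro x
    rw [haarFun_succ_add, bisect_apply, mul_smul]
    split_ifs with hx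
    · rw [haarFun_eq_zero hm (fun h => by have := h.1; linarith), zero_smul, smul_zero]
    · rfl
  simp only [haarCoeff, h]
  rw [integral_halves (f := fun _ => 0) (g := fun y => √2 • haarFun k m y • g y)
    (integrable_zero _ _ _)
    ((integrable_haarFun_smul (integrable_simpleFunc_unitMeasure g) k m).smul _), integral_smul]
  simp only [integral_zero, zero_add, smul_smul]
  congr 1
  have := Real.sq_sqrt (show (0 : ℝ) ≤ 2 by norm_num)
  field_simp
  linarith

theorem haarCoeff_bisect_zero (f g : SimpleFunc ℝ X) :
    haarCoeff (bisect f g) 0 0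
      = (1 / 2 : ℝ) • (∫ x, g x ∂unitMeasure - ∫ x, f x ∂unitMeasure) := by
  have h : ∀ᵐ x ∂unitMeasure, haarFun 0 0 x • bisect f g x
      = if x < 1 / 2 then (fun y => -f y) (2 * x) else g (2 * x - 1) := by
    refine (ae_restrict_iff' measurableSet_Ico).2 (ae_of_all _ fun x hx => ?_)
    rw [haarFun_zero_zero hx, bisect_apply]
    split_ifs <;> simp
  rw [haarCoeff, integral_congr_ae h, integral_halves (f := fun y => -f y)
    (integrable_simpleFunc_unitMeasure f).neg (integrable_simpleFunc_unitMeasure g), integral_neg,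
    sub_eq_neg_add]

/-- A constant is the bisection of itself, so self-similarity reduces every generation to generation
zero. -/
theorem haarCoeff_const (c : X) (k m : ℕ) (hm : m < 2 ^ k) :
    haarCoeff (SimpleFunc.const ℝ c) k m = 0 := by
  have hb : ∀ c : X, bisect (SimpleFunc.const ℝ c) (SimpleFunc.const ℝ c)
      = SimpleFunc.const ℝ c := by
    intro c; ext x; simp [bisect_apply]
  induction k generalizing m with
  | zero =>
    obtain rfl : m = 0 := by simpa using hm
    rw [← hb, haarCoeff_bisect_zero, sub_self, smul_zero]
  | succ k ih =>
    rw [← hb]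
    rcases lt_or_ge m (2 ^ k) with h | h
    · rw [haarCoeff_bisect_left _ _ h, ih _ h, smul_zero]
    · obtain ⟨j, rfl⟩ := Nat.exists_eq_add_of_le h
      have hj : j < 2 ^ k := by rw [pow_succ] at hm; omega
      rw [haarCoeff_bisect_right _ _ hj, ih _ hj, smul_zero]

theorem dyadicHilbertPartial_const (c : X) (n : ℕ) (x : ℝ) :
    dyadicHilbertPartial n (SimpleFunc.const ℝ c) x = 0 := by
  refine Finset.sum_eq_zero fun k _ => Finset.sum_eq_zero fun m hm => ?_
  rw [Finset.mem_range] at hm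
  rw [haarCoeff_const _ _ _ (by rw [pow_succ]; omega),
    haarCoeff_const _ _ _ (by rw [pow_succ]; omega), smul_zero, smul_zero, sub_zero]

theorem dyadicHilbertPartial_eq_zero (n : ℕ) (f : ℝ → X) {x : ℝ} (hx : x ∉ Set.Ico (0 : ℝ) 1) :
    dyadicHilbertPartial n f x = 0 := by
  refine Finset.sum_eq_zero fun k _ => Finset.sum_eq_zero fun m hm => ?_
  rw [Finset.mem_range] at hm
  rw [haarFun_eq_zero (by rw [pow_succ]; omega) hx, haarFun_eq_zero (by rw [pow_succ]; omega) hx,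
    zero_smul, zero_smul, sub_zero]

theorem sqrt_two_mul_smul_inv (a : ℝ) (y : X) : (√2 * a) • (√2)⁻¹ • y = a • y := by
  rw [smul_smul]
  congr 1
  field_simp

/-- Only the siblings `[0,1/2)` and `[1/2,1)` interact across the midpoint, which gives the last
bracket. All later sibling pairs lie in one half and reproduce the operator on that half; the
factors `√2` and `1/√2` cancel. -/
theorem dyadicHilbertPartial_succ_bisect (n : ℕ) (f g : SimpleFunc ℝ X) (x : ℝ) :
    dyadicHilbertPartial (n + 1) (bisect f g) x
      = (dyadicHilbertPartial n f (2 * x) + dyadicHilbertPartial n g (2 * x - 1))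
        + (haarFun 0 0 (2 * x) • haarCoeff g 0 0 - haarFun 0 0 (2 * x - 1) • haarCoeff f 0 0) := by
  rw [dyadicHilbertPartial, Finset.sum_range_succ']
  congr 1
  · simp only [dyadicHilbertPartial, ← Finset.sum_add_distrib]
    refine Finset.sum_congr rfl fun k _ => ?_
    rw [pow_succ, mul_two, Finset.sum_range_add, Finset.sum_add_distrib]
    congr 1 <;> refine Finset.sum_congr rfl fun m hm => ?_
    · rw [Finset.mem_range] at hm
      rw [haarFun_succ (k + 1) _ x, haarFun_succ (k + 1) _ x, haarCoeff_bisect_left _ _ (by rw [pow_succ]; omega),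
        haarCoeff_bisect_left _ _ (by rw [pow_succ]; omega), sqrt_two_mul_smul_inv,
        sqrt_two_mul_smul_inv]
    · rw [Finset.mem_range] at hm
      have h1 : 2 * (2 ^ k + m) + 1 = 2 ^ (k + 1) + (2 * m + 1) := by ring
      have h2 : 2 * (2 ^ k + m) = 2 ^ (k + 1) + 2 * m := by ring
      rw [h1, h2, haarFun_succ_add, haarFun_succ_add,
        haarCoeff_bisect_right _ _ (by rw [pow_succ]; omega),
        haarCoeff_bisect_right _ _ (by rw [pow_succ]; omega), sqrt_two_mul_smul_inv,
        sqrt_two_mul_smul_inv]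
  · have h0 := haarFun_succ 0 0 x
    have h1 := haarFun_succ_add 0 0 x
    have c0 := haarCoeff_bisect_left f g (k := 0) (m := 0) (by norm_num)
    have c1 := haarCoeff_bisect_right f g (k := 0) (m := 0) (by norm_num)
    simp only [pow_zero, zero_add, add_zero] at h0 h1 c0 c1
    simp only [pow_zero, Finset.range_one, Finset.sum_singleton, mul_zero, zero_add, h0, h1, c0, c1,
      sqrt_two_mul_smul_inv]

theorem dyadicHilbertPartial_bisect_left (n : ℕ) (f g : SimpleFunc ℝ X) {x : ℝ} (hx : x < 1 / 2) :
    dyadicHilbertPartial (n + 1) (bisect f g) x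
      = dyadicHilbertPartial n f (2 * x) + haarFun 0 0 (2 * x) • haarCoeff g 0 0 := by
  have : 2 * x - 1 ∉ Set.Ico (0 : ℝ) 1 := fun h => by have := h.1; linarith
  rw [dyadicHilbertPartial_succ_bisect, dyadicHilbertPartial_eq_zero _ _ this,
    haarFun_eq_zero (by norm_num) this, zero_smul, add_zero, sub_zero]

theorem dyadicHilbertPartial_bisect_right (n : ℕ) (f g : SimpleFunc ℝ X) {x : ℝ}
    (hx : ¬ x < 1 / 2) :
    dyadicHilbertPartial (n + 1) (bisect f g) x
      = dyadicHilbertPartial n g (2 * x - 1) - haarFun 0 0 (2 * x - 1) • haarCoeff f 0 0 := by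
  have : 2 * x ∉ Set.Ico (0 : ℝ) 1 := fun h => by have := h.2; linarith
  rw [dyadicHilbertPartial_succ_bisect, dyadicHilbertPartial_eq_zero _ _ this,
    haarFun_eq_zero (by norm_num) this, zero_smul, zero_add, zero_sub, ← sub_eq_add_neg]

theorem dyadicHilbertPartial_clm_comp [CompleteSpace X] {f : ℝ → ℂ} (hf : Integrable f unitMeasure)
    (L : ℂ →L[ℝ] X) (n : ℕ) (x : ℝ) :
    dyadicHilbertPartial n (fun y => L (f y)) x = L (dyadicHilbertPartial n f x) := by
  have hc : ∀ k m, haarCoeff (fun y => L (f y)) k m = L (haarCoeff f k m) := by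
    intro k m
    rw [haarCoeff, haarCoeff, ← L.integral_comp_comm (integrable_haarFun_smul hf k m)]
    simp only [map_smul]
  simp only [dyadicHilbertPartial, hc, map_sum, map_sub, map_smul]

end Dyadic

/-! ### The random walk and the action of the dyadic Hilbert transform on its martingales -/

/-- A state consists of a position in the disc and, for each `n`, the current value of the
martingale that approximates the `n`-th power of the position. One step moves the position by `δ c`
and the martingales by the corresponding first order increments. -/
noncomputable def walkStep (δ : ℝ) (c : ℂ) (s : ℂ × (ℕ → ℂ)) : ℂ × (ℕ → ℂ) :=
  (s.1 + δ * c, fun n => s.2 n + δ * c * (n * s.1 ^ (n - 1)))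

/-- The state after at most `N` steps of the random walk started at `s`, as a function on `[0, 1)`.
Each step uses two binary digits: the first one decides whether to move vertically or horizontally,
the second one in which direction. The walk stops when it comes within `δ` of the unit circle. -/
noncomputable def walk (δ : ℝ) : ℕ → ℂ × (ℕ → ℂ) → SimpleFunc ℝ (ℂ × (ℕ → ℂ))
  | 0, s => SimpleFunc.const ℝ s
  | N + 1, s =>
    if ‖s.1‖ + δ ≤ 1 then
      bisect
        (bisect (walk δ N (walkStep δ (-Complex.I) s)) (walk δ N (walkStep δ Complex.I s)))
        (bisect (walk δ N (walkStep δ (-1) s)) (walk δ N (walkStep δ 1 s)))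
    else SimpleFunc.const ℝ s

section Mean

variable {E : Type*} [NormedAddCommGroup E] (δ : ℝ) (N : ℕ) (s : ℂ × (ℕ → ℂ))

theorem integrable_walk (φ : ℂ × (ℕ → ℂ) → E) :
    Integrable (fun x => φ (walk δ N s x)) unitMeasure :=
  integrable_simpleFunc_unitMeasure ((walk δ N s).map φ)

theorem memLp_walk (φ : ℂ × (ℕ → ℂ) → E) (p : ℝ≥0∞) :
    MemLp (fun x => φ (walk δ N s x)) p unitMeasure :=
  SimpleFunc.memLp_of_isFiniteMeasure ((walk δ N s).map φ) p _

variable [NormedSpace ℝ E] [CompleteSpace E]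

theorem integral_walk_zero (φ : ℂ × (ℕ → ℂ) → E) :
    ∫ x, φ (walk δ 0 s x) ∂unitMeasure = φ s := by
  simp [walk]

variable {δ s}

theorem integral_walk_of_stopped (hs : ¬ ‖s.1‖ + δ ≤ 1) (φ : ℂ × (ℕ → ℂ) → E) :
    ∫ x, φ (walk δ N s x) ∂unitMeasure = φ s := by
  cases N <;> simp [walk, hs]

omit [CompleteSpace E] in
theorem integral_walk_succ (hs : ‖s.1‖ + δ ≤ 1) (φ : ℂ × (ℕ → ℂ) → E) :
    ∫ x, φ (walk δ (N + 1) s x) ∂unitMeasure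
      = (1 / 4 : ℝ) • ((∫ x, φ (walk δ N (walkStep δ (-Complex.I) s) x) ∂unitMeasure
        + ∫ x, φ (walk δ N (walkStep δ Complex.I s) x) ∂unitMeasure)
        + (∫ x, φ (walk δ N (walkStep δ (-1) s) x) ∂unitMeasure
        + ∫ x, φ (walk δ N (walkStep δ 1 s) x) ∂unitMeasure)) := by
  have h : ∀ x, φ (walk δ (N + 1) s x) = (walk δ (N + 1) s).map φ x := fun x => rfl
  simp only [h]
  rw [walk, if_pos hs, map_bisect, map_bisect, map_bisect, integral_bisect, integral_bisect,
    integral_bisect, ← smul_add, smul_smul]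
  norm_num

/-- Iteration of a one-step growth bound; `1 ≤ κ` and positivity of `φ` cover the paths that have
already stopped. -/
theorem integral_walk_le {φ : ℂ × (ℕ → ℂ) → ℝ} {κ : ℝ} (hκ : 1 ≤ κ) (hφ : ∀ s, 0 ≤ φ s)
    (h : ∀ s : ℂ × (ℕ → ℂ), ‖s.1‖ + δ ≤ 1 →
      (1 / 4 : ℝ) * ((φ (walkStep δ (-Complex.I) s) + φ (walkStep δ Complex.I s))
        + (φ (walkStep δ (-1) s) + φ (walkStep δ 1 s))) ≤ κ * φ s) :
    ∫ x, φ (walk δ N s x) ∂unitMeasure ≤ κ ^ N * φ s := by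
  induction N generalizing s with
  | zero => rw [integral_walk_zero]; simp
  | succ N ih =>
    by_cases hs : ‖s.1‖ + δ ≤ 1
    · rw [integral_walk_succ N hs, smul_eq_mul]
      calc _ ≤ (1 / 4 : ℝ) * ((κ ^ N * φ (walkStep δ (-Complex.I) s)
            + κ ^ N * φ (walkStep δ Complex.I s))
            + (κ ^ N * φ (walkStep δ (-1) s) + κ ^ N * φ (walkStep δ 1 s))) := by
            gcongr <;> exact ih
        _ = κ ^ N * ((1 / 4 : ℝ) * ((φ (walkStep δ (-Complex.I) s) + φ (walkStep δ Complex.I s))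
            + (φ (walkStep δ (-1) s) + φ (walkStep δ 1 s)))) := by ring
        _ ≤ κ ^ N * (κ * φ s) := mul_le_mul_of_nonneg_left (h s hs) (by positivity)
        _ = κ ^ (N + 1) * φ s := by ring
    · rw [integral_walk_of_stopped _ hs]
      exact le_mul_of_one_le_left (hφ s) (one_le_pow₀ hκ)

end Mean

theorem norm_walkStep_fst_le {δ : ℝ} {s : ℂ × (ℕ → ℂ)} (hδ : 0 ≤ δ) (hs : ‖s.1‖ + δ ≤ 1) {c : ℂ}
    (hc : ‖c‖ = 1) : ‖(walkStep δ c s).1‖ ≤ 1 := by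
  refine (norm_add_le _ _).trans ?_
  rw [norm_mul, hc, mul_one, Complex.norm_real, Real.norm_of_nonneg hδ]
  exact hs

theorem norm_walk_fst_le {δ : ℝ} (hδ : 0 ≤ δ) (N : ℕ) {s : ℂ × (ℕ → ℂ)} (hs : ‖s.1‖ ≤ 1) (x : ℝ) :
    ‖(walk δ N s x).1‖ ≤ 1 := by
  induction N generalizing s x with
  | zero => simpa [walk] using hs
  | succ N ih =>
    rw [walk]
    split_ifs with h
    · simp only [bisect_apply]
      split_ifs <;> exact ih (norm_walkStep_fst_le hδ h (by simp)) _
    · simpa using hs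

theorem integral_walk_snd (δ : ℝ) (N : ℕ) (s : ℂ × (ℕ → ℂ)) (n : ℕ) :
    ∫ x, (walk δ N s x).2 n ∂unitMeasure = s.2 n := by
  induction N generalizing s with
  | zero => exact integral_walk_zero δ s fun s => s.2 n
  | succ N ih =>
    by_cases hs : ‖s.1‖ + δ ≤ 1
    · rw [integral_walk_succ N hs fun s => s.2 n]
      simp only [ih, walkStep, Complex.real_smul]
      push_cast
      ring
    · exact integral_walk_of_stopped _ hs fun s => s.2 n

/-- The first digit only selects an axis. Both moves along either axis average to zero, so it leaves
the conditional mean unchanged. -/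
theorem haarCoeff_walk_snd (δ : ℝ) (N : ℕ) (s : ℂ × (ℕ → ℂ)) (n : ℕ) :
    haarCoeff ((walk δ N s).map fun s => s.2 n) 0 0 = 0 := by
  cases N with
  | zero => exact haarCoeff_const (s.2 n) 0 0 (by norm_num)
  | succ N =>
    rw [walk]
    split_ifs with hs
    · have h : ∀ s, ∫ x, (walk δ N s).map (fun s => s.2 n) x ∂unitMeasure = s.2 n :=
        fun s => integral_walk_snd δ N s n
      rw [map_bisect, map_bisect, map_bisect, haarCoeff_bisect_zero, integral_bisect,
        integral_bisect, h, h, h, h]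
      simp only [walkStep, Complex.real_smul]
      push_cast
      ring
    · exact haarCoeff_const (s.2 n) 0 0 (by norm_num)

/-- Within one step the cross terms of the two halves turn `i h_{I₋} + h_{I₊}` into `-i` times
itself. In the next generation the cross terms vanish by `haarCoeff_walk_snd`, and the induction
continues on the four quarters. -/
theorem dyadicHilbertPartial_walk_snd (δ : ℝ) (N : ℕ) (s : ℂ × (ℕ → ℂ)) (n : ℕ) {k : ℕ}
    (hk : 2 * N ≤ k) {x : ℝ} (hx : x ∈ Set.Ico (0 : ℝ) 1) :
    dyadicHilbertPartial k ((walk δ N s).map fun s => s.2 n) x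
      = -Complex.I * ((walk δ N s x).2 n - s.2 n) := by
  induction N generalizing s x k with
  | zero =>
    have : (walk δ 0 s x).2 n = s.2 n := rfl
    rw [this, sub_self, mul_zero]
    exact dyadicHilbertPartial_const (s.2 n) k x
  | succ N ih =>
    -- Each step of the walk consumes two generations.
    obtain ⟨j, rfl⟩ : ∃ j, k = j + 1 + 1 := ⟨k - 2, by omega⟩
    rw [walk]
    split_ifs with hs
    · have hI : ∀ s, ∫ x, (walk δ N s).map (fun s => s.2 n) x ∂unitMeasure = s.2 n :=
        fun s => integral_walk_snd δ N s n
      have hj : 2 * N ≤ j := by omega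
      have hI2 := Complex.I_mul_I
      obtain ⟨hx0, hx1⟩ := hx
      rw [map_bisect, map_bisect, map_bisect]
      simp only [bisect_apply]
      by_cases h1 : x < 1 / 2
      · have hy : 2 * x ∈ Set.Ico (0 : ℝ) 1 := ⟨by linarith, by linarith⟩
        rw [dyadicHilbertPartial_bisect_left _ _ _ h1, haarFun_zero_zero hy,
          haarCoeff_bisect_zero, hI, hI, if_pos h1]
        by_cases h2 : 2 * x < 1 / 2
        · rw [dyadicHilbertPartial_bisect_left _ _ _ h2, haarCoeff_walk_snd,
            ih _ hj ⟨by linarith, by linarith⟩, if_pos h2, if_pos h2]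
          simp only [walkStep, Complex.real_smul, smul_zero]
          push_cast
          linear_combination -(δ * (n * s.1 ^ (n - 1)) : ℂ) * hI2
        · rw [dyadicHilbertPartial_bisect_right _ _ _ h2, haarCoeff_walk_snd,
            ih _ hj ⟨by linarith, by linarith⟩, if_neg h2, if_neg h2]
          simp only [walkStep, Complex.real_smul, smul_zero]
          push_cast
          linear_combination (δ * (n * s.1 ^ (n - 1)) : ℂ) * hI2
      · have hy : 2 * x - 1 ∈ Set.Ico (0 : ℝ) 1 := ⟨by linarith, by linarith⟩
        rw [dyadicHilbertPartial_bisect_right _ _ _ h1, haarFun_zero_zero hy,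
          haarCoeff_bisect_zero, hI, hI, if_neg h1]
        by_cases h2 : 2 * x - 1 < 1 / 2
        · rw [dyadicHilbertPartial_bisect_left _ _ _ h2, haarCoeff_walk_snd,
            ih _ hj ⟨by linarith, by linarith⟩, if_pos h2, if_pos h2]
          simp only [walkStep, Complex.real_smul, smul_zero]
          push_cast
          ring
        · rw [dyadicHilbertPartial_bisect_right _ _ _ h2, haarCoeff_walk_snd,
            ih _ hj ⟨by linarith, by linarith⟩, if_neg h2, if_neg h2]
          simp only [walkStep, Complex.real_smul, smul_zero]
          push_cast
          ring
    · have : dyadicHilbertPartial (j + 1 + 1) (SimpleFunc.const ℝ (s.2 n)) x = 0 :=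
        dyadicHilbertPartial_const _ _ _
      simpa using this

/-! ### Approach to the circle and control of the Taylor error -/

/-- Each step raises the mean of `‖z‖ ^ 2` by `δ ^ 2`, which contracts the mean of `1 - ‖z‖ ^ 2` by
at least the factor `1 - δ ^ 2`. Where the walk has stopped, `1 - ‖z‖ ^ 2 ≤ 2 * (1 - ‖z‖) < 2 * δ`.
-/
theorem integral_one_sub_normSq_walk_le {δ : ℝ} (hδ : 0 ≤ δ) (hδ1 : δ ≤ 1) (N : ℕ)
    {s : ℂ × (ℕ → ℂ)} (hs : ‖s.1‖ ≤ 1) :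
    ∫ x, (1 - ‖(walk δ N s x).1‖ ^ 2) ∂unitMeasure
      ≤ 2 * δ + (1 - δ ^ 2) ^ N * (1 - ‖s.1‖ ^ 2) := by
  have hδ2 : 0 ≤ 1 - δ ^ 2 := by nlinarith
  have hs2 : ∀ {s : ℂ × (ℕ → ℂ)}, ‖s.1‖ ≤ 1 → 0 ≤ 1 - ‖s.1‖ ^ 2 := fun {s} h => by
    nlinarith [norm_nonneg s.1]
  induction N generalizing s with
  | zero =>
    rw [integral_walk_zero δ s fun s => 1 - ‖s.1‖ ^ 2]
    linarith
  | succ N ih =>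
    by_cases h : ‖s.1‖ + δ ≤ 1
    · rw [integral_walk_succ N h fun s => 1 - ‖s.1‖ ^ 2, smul_eq_mul]
      have e1 := ih (norm_walkStep_fst_le hδ h (c := -Complex.I) (by simp))
      have e2 := ih (norm_walkStep_fst_le hδ h (c := Complex.I) (by simp))
      have e3 := ih (norm_walkStep_fst_le hδ h (c := -1) (by simp))
      have e4 := ih (norm_walkStep_fst_le hδ h (c := 1) (by simp))
      have e5 : (1 / 4 : ℝ) * (((1 - ‖(walkStep δ (-Complex.I) s).1‖ ^ 2)
          + (1 - ‖(walkStep δ Complex.I s).1‖ ^ 2))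
          + ((1 - ‖(walkStep δ (-1) s).1‖ ^ 2) + (1 - ‖(walkStep δ 1 s).1‖ ^ 2)))
          = 1 - ‖s.1‖ ^ 2 - δ ^ 2 := by
        simp only [walkStep, ← Complex.normSq_eq_norm_sq, Complex.normSq_apply]
        simp
        ring
      have e6 : 1 - ‖s.1‖ ^ 2 - δ ^ 2 ≤ (1 - δ ^ 2) * (1 - ‖s.1‖ ^ 2) := by
        nlinarith [sq_nonneg (δ * ‖s.1‖)]
      calc _ ≤ (1 / 4 : ℝ) * (((2 * δ + (1 - δ ^ 2) ^ N * (1 - ‖(walkStep δ (-Complex.I) s).1‖ ^ 2))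
              + (2 * δ + (1 - δ ^ 2) ^ N * (1 - ‖(walkStep δ Complex.I s).1‖ ^ 2)))
              + ((2 * δ + (1 - δ ^ 2) ^ N * (1 - ‖(walkStep δ (-1) s).1‖ ^ 2))
              + (2 * δ + (1 - δ ^ 2) ^ N * (1 - ‖(walkStep δ 1 s).1‖ ^ 2)))) := by
            linarith
        _ = 2 * δ + (1 - δ ^ 2) ^ N * (1 - ‖s.1‖ ^ 2 - δ ^ 2) := by rw [← e5]; ring
        _ ≤ 2 * δ + (1 - δ ^ 2) ^ N * ((1 - δ ^ 2) * (1 - ‖s.1‖ ^ 2)) := by gcongr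
        _ = _ := by ring
    · rw [integral_walk_of_stopped _ h fun s => 1 - ‖s.1‖ ^ 2]
      have : 0 ≤ (1 - δ ^ 2) ^ (N + 1) * (1 - ‖s.1‖ ^ 2) := mul_nonneg (pow_nonneg hδ2 _) (hs2 hs)
      nlinarith [norm_nonneg s.1]

/-- Second order Taylor expansion, uniform on the disc. The coefficient `q` may remain implicit:
only its size and its independence of `h` matter for the cancellation. -/
theorem exists_pow_add_taylor (n : ℕ) : ∃ C : ℝ, 0 ≤ C ∧ ∀ z : ℂ, ‖z‖ ≤ 1 → ∃ q : ℂ, ‖q‖ ≤ C ∧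
    ∀ h : ℂ, ‖h‖ ≤ 1 → ‖(z + h) ^ n - z ^ n - h * (n * z ^ (n - 1)) - q * h ^ 2‖ ≤ C * ‖h‖ ^ 3 := by
  induction n with
  | zero => exact ⟨0, le_rfl, fun z _ => ⟨0, by simp, fun h _ => by simp⟩⟩
  | succ n ih =>
    obtain ⟨C, hC, H⟩ := ih
    refine ⟨3 * C + n, by positivity, fun z hz => ?_⟩
    obtain ⟨q, hq, hR⟩ := H z hz
    refine ⟨n * z ^ (n - 1) + z * q, ?_, fun h hh => ?_⟩
    · have h1 : ‖(n : ℂ) * z ^ (n - 1)‖ ≤ n := by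
        rw [norm_mul, norm_pow, Complex.norm_natCast]
        exact mul_le_of_le_one_right (by positivity) (pow_le_one₀ (norm_nonneg _) hz)
      have h2 : ‖z * q‖ ≤ C := by
        rw [norm_mul]
        exact (mul_le_of_le_one_left (norm_nonneg _) hz).trans hq
      linarith [norm_add_le ((n : ℂ) * z ^ (n - 1)) (z * q)]
    · have hz1 : (n : ℂ) * z ^ (n - 1) * z = n * z ^ n := by
        cases n with
        | zero => simp
        | succ n => rw [Nat.add_sub_cancel]; ring
      have e : (z + h) ^ (n + 1) - z ^ (n + 1) - h * (((n + 1 : ℕ) : ℂ) * z ^ (n + 1 - 1))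
          - (n * z ^ (n - 1) + z * q) * h ^ 2
          = (z + h) * ((z + h) ^ n - z ^ n - h * (n * z ^ (n - 1)) - q * h ^ 2) + q * h ^ 3 := by
        rw [Nat.add_sub_cancel]
        push_cast
        linear_combination h * hz1
      rw [e]
      have h1 := hR h hh
      have h2 : ‖z + h‖ ≤ 2 := by linarith [norm_add_le z h]
      refine (norm_add_le _ _).trans ?_
      rw [norm_mul, norm_mul, norm_pow]
      calc _ ≤ 2 * (C * ‖h‖ ^ 3) + C * ‖h‖ ^ 3 := by gcongr
        _ ≤ (3 * C + n) * ‖h‖ ^ 3 := by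
          have : 0 ≤ (n : ℝ) * ‖h‖ ^ 3 := by positivity
          linarith

/-- The martingale removes the first order term of each increment. The second order term has a
random sign and costs a factor `cosh`, hence only the square of `l * (C * δ ^ 2)`; the cubic term is
bounded directly. The parameter `η` selects a direction in the plane. -/
theorem exists_integral_exp_walk_le (n : ℕ) : ∃ C : ℝ, 0 ≤ C ∧ ∀ (δ l : ℝ) (η : ℂ) (N : ℕ)
    (s : ℂ × (ℕ → ℂ)), 0 ≤ δ → δ ≤ 1 → 0 ≤ l → ‖η‖ ≤ 1 →
    ∫ x, Real.exp (l * (η * ((walk δ N s x).1 ^ n - (walk δ N s x).2 n)).re) ∂unitMeasure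
      ≤ Real.exp (l * (C * δ ^ 3) + (l * (C * δ ^ 2)) ^ 2 / 2) ^ N
        * Real.exp (l * (η * (s.1 ^ n - s.2 n)).re) := by
  obtain ⟨C, hC, H⟩ := exists_pow_add_taylor n
  refine ⟨C, hC, fun δ l η N s hδ hδ1 hl hη => ?_⟩
  refine integral_walk_le N (φ := fun s => Real.exp (l * (η * (s.1 ^ n - s.2 n)).re))
    (Real.one_le_exp (by positivity)) (fun s => (Real.exp_pos _).le) fun s hs => ?_
  obtain ⟨q, hq, hR⟩ := H s.1 (by linarith)
  set w : ℝ := l * (δ ^ 2 * (η * q).re) with hw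
  have hwle : |w| ≤ l * (C * δ ^ 2) := by
    have : |(η * q).re| ≤ C := by
      refine (Complex.abs_re_le_norm _).trans ?_
      rw [norm_mul]
      exact (mul_le_of_le_one_left (norm_nonneg _) hη).trans hq
    rw [hw, abs_mul, abs_mul, abs_of_nonneg hl, abs_of_nonneg (sq_nonneg δ), mul_comm C]
    gcongr
  -- The sign `ε` is the square of the direction: `-1` for vertical and `1` for horizontal moves.
  have step : ∀ (c : ℂ) (ε : ℝ), ‖c‖ = 1 → c ^ 2 = ε →
      Real.exp (l * (η * ((walkStep δ c s).1 ^ n - (walkStep δ c s).2 n)).re)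
        ≤ Real.exp (l * (C * δ ^ 3)) * Real.exp (ε * w)
          * Real.exp (l * (η * (s.1 ^ n - s.2 n)).re) := by
    intro c ε hc hε
    have hn : ‖(δ : ℂ) * c‖ = δ := by
      rw [norm_mul, hc, mul_one, Complex.norm_real, Real.norm_of_nonneg hδ]
    have h1 := hR (δ * c) (hn.le.trans hδ1)
    rw [hn] at h1
    set R := (s.1 + δ * c) ^ n - s.1 ^ n - δ * c * (n * s.1 ^ (n - 1)) - q * (δ * c) ^ 2 with hRdef
    have e : η * ((walkStep δ c s).1 ^ n - (walkStep δ c s).2 n)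
        = η * (s.1 ^ n - s.2 n) + η * R + ((δ ^ 2 * ε : ℝ) : ℂ) * (η * q) := by
      simp only [walkStep, hRdef]
      push_cast
      linear_combination η * q * δ ^ 2 * hε
    have h2 : (η * R).re ≤ C * δ ^ 3 := by
      refine (Complex.re_le_norm _).trans ?_
      rw [norm_mul]
      exact (mul_le_of_le_one_left (norm_nonneg _) hη).trans h1
    rw [← Real.exp_add, ← Real.exp_add, e, Complex.add_re, Complex.add_re, Complex.re_ofReal_mul]
    refine Real.exp_le_exp.2 ?_
    have h3 := mul_le_mul_of_nonneg_left h2 hl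
    rw [hw]
    nlinarith
  have s1 := step (-Complex.I) (-1) (by simp) (by simp)
  have s2 := step Complex.I (-1) (by simp) (by simp)
  have s3 := step (-1) 1 (by simp) (by simp)
  have s4 := step 1 1 (by simp) (by simp)
  have hcosh : (Real.exp (1 * w) + Real.exp (-1 * w)) / 2
      ≤ Real.exp ((l * (C * δ ^ 2)) ^ 2 / 2) := by
    have h1 := Real.cosh_le_exp_half_sq w
    rw [Real.cosh_eq] at h1
    rw [one_mul, neg_one_mul]
    refine h1.trans (Real.exp_le_exp.2 ?_)
    have := pow_le_pow_left₀ (abs_nonneg w) hwle 2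
    rw [sq_abs] at this
    linarith
  have hpos : 0 ≤ Real.exp (l * (C * δ ^ 3)) * Real.exp (l * (η * (s.1 ^ n - s.2 n)).re) := by
    positivity
  have := mul_le_mul_of_nonneg_left hcosh hpos
  rw [Real.exp_add]
  linarith

/-- Random walks in the unit disc, started at `0`, with step size tending to `0` and so many steps
that their end points become equidistributed on the circle. -/
noncomputable def diskWalk (m : ℕ) : SimpleFunc ℝ (ℂ × (ℕ → ℂ)) :=
  walk (1 / ((m : ℝ) + 1) ^ 2) ((m + 1) ^ 5) (0, fun n => 0 ^ n)

theorem one_div_succ_sq_le_one (m : ℕ) : 1 / ((m : ℝ) + 1) ^ 2 ≤ 1 := by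
  rw [div_le_one (by positivity)]
  exact one_le_pow₀ (by linarith [(Nat.cast_nonneg m : (0 : ℝ) ≤ m)])

theorem norm_diskWalk_fst_le (m : ℕ) (x : ℝ) : ‖(diskWalk m x).1‖ ≤ 1 :=
  norm_walk_fst_le (by positivity) _ (by simp) x

theorem integrable_diskWalk {E : Type*} [NormedAddCommGroup E] (m : ℕ) (φ : ℂ × (ℕ → ℂ) → E) :
    Integrable (fun x => φ (diskWalk m x)) unitMeasure :=
  integrable_walk _ _ _ φ

theorem memLp_diskWalk {E : Type*} [NormedAddCommGroup E] (m : ℕ) (φ : ℂ × (ℕ → ℂ) → E)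
    (p : ℝ≥0∞) : MemLp (fun x => φ (diskWalk m x)) p unitMeasure :=
  memLp_walk _ _ _ φ p

theorem tendsto_natCast_add_one : Tendsto (fun m : ℕ => (m : ℝ) + 1) atTop atTop :=
  tendsto_atTop_add_const_right _ _ tendsto_natCast_atTop_atTop

theorem tendsto_integral_one_sub_normSq_diskWalk :
    Tendsto (fun m => ∫ x, (1 - ‖(diskWalk m x).1‖ ^ 2) ∂unitMeasure) atTop (𝓝 0) := by
  have hle : ∀ m : ℕ, ∫ x, (1 - ‖(diskWalk m x).1‖ ^ 2) ∂unitMeasure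
      ≤ 2 * (1 / ((m : ℝ) + 1) ^ 2) + Real.exp (-((m : ℝ) + 1)) := by
    intro m
    have hm : (0 : ℝ) < (m : ℝ) + 1 := by positivity
    set δ : ℝ := 1 / ((m : ℝ) + 1) ^ 2 with hδ
    have hδ0 : 0 ≤ δ := by positivity
    have hδ1 : δ ≤ 1 := one_div_succ_sq_le_one m
    have h := integral_one_sub_normSq_walk_le hδ0 hδ1 ((m + 1) ^ 5) (s := (0, fun n => 0 ^ n))
      (by simp)
    refine h.trans (add_le_add le_rfl ?_)
    have h1 : 1 - δ ^ 2 ≤ Real.exp (-δ ^ 2) := by linarith [Real.add_one_le_exp (-δ ^ 2)]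
    have h2 : 0 ≤ 1 - δ ^ 2 := by nlinarith
    calc _ ≤ Real.exp (-δ ^ 2) ^ ((m + 1) ^ 5) := by
          simpa using pow_le_pow_left₀ h2 h1 ((m + 1) ^ 5)
      _ = Real.exp (-((m : ℝ) + 1)) := by
          rw [← Real.exp_nat_mul, hδ]
          congr 1
          push_cast
          field_simp
  refine squeeze_zero (fun m => integral_nonneg fun x => ?_) hle ?_
  · have := norm_diskWalk_fst_le m x
    have := norm_nonneg (diskWalk m x).1
    simp only [Pi.zero_apply]
    nlinarith
  · have h1 : Tendsto (fun m : ℕ => 1 / ((m : ℝ) + 1) ^ 2) atTop (𝓝 0) := by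
      simp only [one_div]
      exact tendsto_inv_atTop_zero.comp
        ((tendsto_pow_atTop two_ne_zero).comp tendsto_natCast_add_one)
    have h2 : Tendsto (fun m : ℕ => Real.exp (-((m : ℝ) + 1))) atTop (𝓝 0) :=
      Real.tendsto_exp_neg_atTop_nhds_zero.comp tendsto_natCast_add_one
    simpa using (h1.const_mul 2).add h2

/-- With `l = m + 1`, `δ = (m + 1)⁻²` and `N = (m + 1) ^ 5`, one has `N * l * δ ^ 3 = 1` and `N * l
^ 2 * δ ^ 4 = (m + 1)⁻¹`, so the exponent stays bounded while `l` tends to infinity. -/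
theorem exists_integral_exp_diskWalk_le (n : ℕ) : ∃ K : ℝ, ∀ (m : ℕ) (η : ℂ), ‖η‖ ≤ 1 →
    ∫ x, Real.exp (((m : ℝ) + 1) * (η * ((diskWalk m x).1 ^ n - (diskWalk m x).2 n)).re)
      ∂unitMeasure ≤ K := by
  obtain ⟨C, hC, H⟩ := exists_integral_exp_walk_le n
  refine ⟨Real.exp (C + C ^ 2 / 2), fun m η hη => ?_⟩
  have hm : (0 : ℝ) < (m : ℝ) + 1 := by positivity
  have hm1 : (1 : ℝ) ≤ (m : ℝ) + 1 := by linarith [(Nat.cast_nonneg m : (0 : ℝ) ≤ m)]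
  refine (H (1 / ((m : ℝ) + 1) ^ 2) (m + 1) η ((m + 1) ^ 5) (0, fun n => 0 ^ n) (by positivity)
    (one_div_succ_sq_le_one m) hm.le hη).trans ?_
  simp only [sub_self, mul_zero, Complex.zero_re, Real.exp_zero, mul_one]
  rw [← Real.exp_nat_mul]
  refine Real.exp_le_exp.2 ?_
  have e : (((m + 1) ^ 5 : ℕ) : ℝ) * (((m : ℝ) + 1) * (C * (1 / ((m : ℝ) + 1) ^ 2) ^ 3)
      + (((m : ℝ) + 1) * (C * (1 / ((m : ℝ) + 1) ^ 2) ^ 2)) ^ 2 / 2)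
      = C + C ^ 2 / 2 * (1 / ((m : ℝ) + 1)) := by
    push_cast
    field_simp
  rw [e]
  have h1 : 1 / ((m : ℝ) + 1) ≤ 1 := by rwa [div_le_one hm]
  have h2 : C ^ 2 / 2 * (1 / ((m : ℝ) + 1)) ≤ C ^ 2 / 2 := mul_le_of_le_one_right (by positivity) h1
  linarith

/-- One of `±Re w`, `±Im w` is at least `‖w‖ / 2`, and `t ^ k / k! ≤ exp t` for `t ≥ 0`. -/
theorem pow_norm_le_sum_exp (k : ℕ) {l : ℝ} (hl : 0 < l) (w : ℂ) :
    ‖w‖ ^ k ≤ 2 ^ k * k.factorial / l ^ k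
      * (Real.exp (l * (1 * w).re) + Real.exp (l * (-1 * w).re)
        + (Real.exp (l * (Complex.I * w).re) + Real.exp (l * (-Complex.I * w).re))) := by
  have h1 : Real.exp (l * ‖w‖ / 2) ≤ Real.exp (l * (1 * w).re) + Real.exp (l * (-1 * w).re)
        + (Real.exp (l * (Complex.I * w).re) + Real.exp (l * (-Complex.I * w).re)) := by
    have hw := Complex.norm_le_abs_re_add_abs_im w
    simp only [one_mul, neg_mul, Complex.neg_re, Complex.I_mul_re, neg_neg]
    have p1 := Real.exp_pos (l * w.re)
    have p2 := Real.exp_pos (l * -w.re)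
    have p3 := Real.exp_pos (l * w.im)
    have p4 := Real.exp_pos (l * -w.im)
    have key : ∀ a : ℝ, ‖w‖ / 2 ≤ a → Real.exp (l * ‖w‖ / 2) ≤ Real.exp (l * a) := by
      intro a ha
      refine Real.exp_le_exp.2 ?_
      rw [mul_div_assoc]
      gcongr
    rcases le_total |w.re| |w.im| with h | h
    · rcases abs_cases w.im with ⟨h', -⟩ | ⟨h', -⟩
      · linarith [key w.im (by linarith)]
      · linarith [key (-w.im) (by linarith)]
    · rcases abs_cases w.re with ⟨h', -⟩ | ⟨h', -⟩
      · linarith [key w.re (by linarith)]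
      · linarith [key (-w.re) (by linarith)]
  have h2 := Real.pow_div_factorial_le_exp (l * ‖w‖ / 2) (by positivity) k
  have hf : (0 : ℝ) < k.factorial := by exact_mod_cast k.factorial_pos
  calc ‖w‖ ^ k = 2 ^ k * k.factorial / l ^ k * ((l * ‖w‖ / 2) ^ k / k.factorial) := by
        rw [div_pow, mul_pow]
        field_simp
    _ ≤ _ := by gcongr; exact h2.trans h1

theorem tendsto_integral_pow_norm_diskWalk_sub (n : ℕ) {k : ℕ} (hk : k ≠ 0) :
    Tendsto (fun m => ∫ x, ‖(diskWalk m x).1 ^ n - (diskWalk m x).2 n‖ ^ k ∂unitMeasure)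
      atTop (𝓝 0) := by
  obtain ⟨K, hK⟩ := exists_integral_exp_diskWalk_le n
  have hle : ∀ m : ℕ, ∫ x, ‖(diskWalk m x).1 ^ n - (diskWalk m x).2 n‖ ^ k ∂unitMeasure
      ≤ 2 ^ k * k.factorial / ((m : ℝ) + 1) ^ k * (K + K + (K + K)) := by
    intro m
    have hm : (0 : ℝ) < (m : ℝ) + 1 := by positivity
    have hint : ∀ η : ℂ, Integrable (fun x => Real.exp (((m : ℝ) + 1)
        * (η * ((diskWalk m x).1 ^ n - (diskWalk m x).2 n)).re)) unitMeasure := fun η =>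
      integrable_diskWalk m fun s => Real.exp (((m : ℝ) + 1) * (η * (s.1 ^ n - s.2 n)).re)
    have i1 := hint 1
    have i2 := hint (-1)
    have i3 := hint Complex.I
    have i4 := hint (-Complex.I)
    refine (integral_mono (integrable_diskWalk m fun s => ‖s.1 ^ n - s.2 n‖ ^ k)
      (((i1.add i2).add (i3.add i4)).const_mul (2 ^ k * k.factorial / ((m : ℝ) + 1) ^ k))
      fun x => pow_norm_le_sum_exp k hm _).trans ?_
    rw [integral_const_mul]
    refine mul_le_mul_of_nonneg_left ?_ (by positivity)
    rw [integral_add' (i1.add i2) (i3.add i4), integral_add' i1 i2, integral_add' i3 i4]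
    have := hK m 1 (by simp)
    have := hK m (-1) (by simp)
    have := hK m Complex.I (by simp)
    have := hK m (-Complex.I) (by simp)
    linarith
  refine squeeze_zero (fun m => integral_nonneg fun x => by positivity) hle ?_
  have h1 : Tendsto (fun m : ℕ => (((m : ℝ) + 1) ^ k)⁻¹) atTop (𝓝 0) :=
    tendsto_inv_atTop_zero.comp ((tendsto_pow_atTop hk).comp tendsto_natCast_add_one)
  simpa [div_eq_mul_inv] using (h1.const_mul (2 ^ k * (k.factorial : ℝ))).mul_const (K + K + (K + K))

theorem tendsto_eLpNorm_diskWalk_sub (n : ℕ) {p : ℝ≥0∞} (hp : p ≠ ∞) :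
    Tendsto (fun m => eLpNorm (fun x => (diskWalk m x).1 ^ n - (diskWalk m x).2 n) p unitMeasure)
      atTop (𝓝 0) := by
  obtain ⟨k, hk0, hk⟩ : ∃ k : ℕ, k ≠ 0 ∧ p ≤ k := by
    obtain ⟨k, hk⟩ := ENNReal.exists_nat_gt hp
    exact ⟨k, fun h => by simp [h] at hk, hk.le⟩
  refine tendsto_of_tendsto_of_tendsto_of_le_of_le tendsto_const_nhds ?_ (fun m => zero_le)
    fun m => eLpNorm_le_eLpNorm_of_exponent_le hk
      (memLp_diskWalk m (fun s => s.1 ^ n - s.2 n) p).aestronglyMeasurable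
  have e : ∀ m, eLpNorm (fun x => (diskWalk m x).1 ^ n - (diskWalk m x).2 n) k unitMeasure
      = ENNReal.ofReal ((∫ x, ‖(diskWalk m x).1 ^ n - (diskWalk m x).2 n‖ ^ k ∂unitMeasure)
        ^ ((k : ℝ)⁻¹)) := by
    intro m
    rw [(memLp_diskWalk m (fun s => s.1 ^ n - s.2 n) k).eLpNorm_eq_integral_rpow_norm
      (by exact_mod_cast hk0) (ENNReal.natCast_ne_top k)]
    simp
  simp only [e]
  have h := (tendsto_integral_pow_norm_diskWalk_sub n hk0).rpow_const (p := (k : ℝ)⁻¹)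
    (Or.inr (by positivity))
  rw [Real.zero_rpow (by positivity)] at h
  simpa using ENNReal.tendsto_ofReal h

/-- The accompanying martingale has mean exactly `0 ^ n`, and the error tends to `0` in `L¹`. -/
theorem tendsto_integral_diskWalk_pow (n : ℕ) :
    Tendsto (fun m => ∫ x, (diskWalk m x).1 ^ n ∂unitMeasure) atTop (𝓝 (0 ^ n)) := by
  rw [tendsto_iff_norm_sub_tendsto_zero]
  refine squeeze_zero (fun m => norm_nonneg _) (fun m => ?_)
    (tendsto_integral_pow_norm_diskWalk_sub n one_ne_zero)
  have h : ∫ x, (diskWalk m x).2 n ∂unitMeasure = 0 ^ n := integral_walk_snd _ _ _ n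
  rw [← h, ← integral_sub (integrable_diskWalk m fun s => s.1 ^ n)
    (integrable_diskWalk m fun s => s.2 n)]
  simpa using norm_integral_le_integral_norm _

/-! ### Equidistribution of the end points on the circle -/

section Equidistribution

open AddCircle

local notation "𝕋" => AddCircle (2 * Real.pi)

theorem fourier_natCast (n : ℕ) (θ : 𝕋) : (fourier n θ : ℂ) = fourier 1 θ ^ n := by
  simp [fourier_apply, toCircle_nsmul]

theorem exists_fourier_one_eq {z : ℂ} (hz : ‖z‖ = 1) : ∃ θ : 𝕋, (fourier 1 θ : ℂ) = z := by
  refine ⟨(Complex.arg z : ℝ), ?_⟩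
  rw [fourier_coe_apply]
  conv_rhs => rw [← Complex.norm_mul_exp_arg_mul_I z, hz]
  have : (Real.pi : ℂ) ≠ 0 := by exact_mod_cast Real.pi_ne_zero
  push_cast
  rw [one_mul]
  congr 1
  field_simp

/-- A function on the disc that is asymptotically integrated by the walk to its mean on the
circle. -/
def IsWalkAverage (G : ℂ → ℂ) : Prop :=
  Tendsto (fun m => ∫ x, G (diskWalk m x).1 ∂unitMeasure) atTop
    (𝓝 (∫ θ : 𝕋, G (fourier 1 θ) ∂haarAddCircle))

theorem integral_fourier_one_pow (n : ℕ) :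
    ∫ θ : 𝕋, (fourier 1 θ : ℂ) ^ n ∂haarAddCircle = 0 ^ n := by
  simp only [← fourier_natCast]
  have h0 := congrFun (fourierCoeff_fourier (T := 2 * Real.pi) (n : ℤ)) 0
  simp only [fourierCoeff, neg_zero, fourier_zero, one_smul] at h0
  rw [h0]
  rcases eq_or_ne n 0 with rfl | hn
  · simp
  · simp [hn]

theorem isWalkAverage_pow (n : ℕ) : IsWalkAverage fun z => z ^ n := by
  unfold IsWalkAverage
  rw [integral_fourier_one_pow]
  exact tendsto_integral_diskWalk_pow n

theorem isWalkAverage_conj {G : ℂ → ℂ} (h : IsWalkAverage G) :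
    IsWalkAverage fun z => (starRingEnd ℂ) (G z) := by
  unfold IsWalkAverage at *
  simp only [integral_conj]
  exact (Complex.continuous_conj.tendsto _).comp h

/-- The walk ends inside the disc, so trigonometric polynomials must be extended to the plane: by
powers of `z` and their conjugates. -/
theorem exists_isWalkAverage_of_mem_span {h : C(𝕋, ℂ)}
    (hh : h ∈ Submodule.span ℂ (Set.range fun n : ℤ => (fourier n : C(𝕋, ℂ)))) :
    ∃ G : ℂ → ℂ, Continuous G ∧ (∀ θ, G (fourier 1 θ) = h θ) ∧ IsWalkAverage G := by
  induction hh using Submodule.span_induction with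
  | mem h hh =>
    obtain ⟨n, rfl⟩ := hh
    obtain ⟨k, rfl | rfl⟩ := n.eq_nat_or_neg
    · exact ⟨fun z => z ^ k, by fun_prop, fun θ => (fourier_natCast k θ).symm, isWalkAverage_pow k⟩
    · refine ⟨fun z => (starRingEnd ℂ) (z ^ k), Complex.continuous_conj.comp (by fun_prop),
        fun θ => ?_, isWalkAverage_conj (isWalkAverage_pow k)⟩
      simp only [← fourier_natCast]
      exact fourier_neg.symm
  | zero => exact ⟨0, continuous_const, fun θ => rfl, by simp [IsWalkAverage]⟩
  | add h₁ h₂ _ _ ih₁ ih₂ =>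
    obtain ⟨G₁, c₁, e₁, w₁⟩ := ih₁
    obtain ⟨G₂, c₂, e₂, w₂⟩ := ih₂
    refine ⟨fun z => G₁ z + G₂ z, c₁.add c₂, fun θ => congrArg₂ (· + ·) (e₁ θ) (e₂ θ), ?_⟩
    unfold IsWalkAverage at *
    have i : ∀ h : C(𝕋, ℂ), Integrable (fun θ => h θ) haarAddCircle := fun h =>
      h.continuous.integrable_of_hasCompactSupport (HasCompactSupport.of_compactSpace _)
    simp only [e₁, e₂] at *
    rw [integral_add (i h₁) (i h₂)]
    refine (w₁.add w₂).congr fun m => ?_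
    rw [integral_add (integrable_diskWalk m fun s => G₁ s.1) (integrable_diskWalk m fun s => G₂ s.1)]
  | smul a h _ ih =>
    obtain ⟨G, c, e, w⟩ := ih
    refine ⟨fun z => a * G z, c.const_mul a, fun θ => congrArg (a * ·) (e θ), ?_⟩
    unfold IsWalkAverage at *
    simp only [integral_const_mul]
    exact w.const_mul a

/-- The part of the closed disc where `ε ≤ ‖K z‖` is compact and misses the circle, so `‖K z‖ / (1 -
‖z‖ ^ 2)` is bounded there. -/
theorem exists_le_add_mul_one_sub_normSq {K : ℂ → ℂ} (hK : Continuous K) {ε : ℝ}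
    (hε : ∀ z, ‖z‖ = 1 → ‖K z‖ < ε) :
    ∃ C : ℝ, ∀ z, ‖z‖ ≤ 1 → ‖K z‖ ≤ ε + C * (1 - ‖z‖ ^ 2) := by
  have hcomp : IsCompact (Metric.closedBall (0 : ℂ) 1 ∩ {z | ε ≤ ‖K z‖}) :=
    (isCompact_closedBall 0 1).inter_right (isClosed_le continuous_const hK.norm)
  have hcont : ContinuousOn (fun z : ℂ => ‖K z‖ / (1 - ‖z‖ ^ 2))
      (Metric.closedBall (0 : ℂ) 1 ∩ {z | ε ≤ ‖K z‖}) := by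
    refine hK.norm.continuousOn.div (by fun_prop) fun z hz h => ?_
    have h1 : ‖z‖ = 1 := by
      have : ‖z‖ ^ 2 = 1 := by linarith
      exact (pow_eq_one_iff_of_nonneg (norm_nonneg z) two_ne_zero).1 this
    exact absurd (hε z h1) (not_lt.2 hz.2)
  obtain ⟨C, hC⟩ := (hcomp.image_of_continuousOn hcont).bddAbove
  refine ⟨max C 0, fun z hz => ?_⟩
  have h0 : 0 ≤ 1 - ‖z‖ ^ 2 := by nlinarith [norm_nonneg z]
  have hε0 : 0 < ε := (norm_nonneg _).trans_lt (hε 1 (by simp))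
  rcases lt_or_ge ‖K z‖ ε with h | h
  · have : 0 ≤ max C 0 * (1 - ‖z‖ ^ 2) := by positivity
    linarith
  · have hz1 : ‖z‖ ≠ 1 := fun h1 => absurd (hε z h1) (not_lt.2 h)
    have hz2 : ‖z‖ < 1 := lt_of_le_of_ne hz hz1
    have hpos : 0 < 1 - ‖z‖ ^ 2 := by nlinarith [norm_nonneg z]
    have := hC ⟨z, ⟨by simpa using hz, h⟩, rfl⟩
    rw [div_le_iff₀ hpos] at this
    have h3 : C * (1 - ‖z‖ ^ 2) ≤ max C 0 * (1 - ‖z‖ ^ 2) := by gcongr; exact le_max_left _ _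
    linarith

/-- A trigonometric polynomial approximates `G` uniformly on the circle. Inside the disc its
extension may be far from `G`, but the discrepancy is controlled by `1 - ‖z‖ ^ 2`, whose mean along
the walk vanishes in the limit. -/
theorem isWalkAverage_of_continuous {G : ℂ → ℂ} (hG : Continuous G) : IsWalkAverage G := by
  unfold IsWalkAverage
  rw [Metric.tendsto_atTop']
  intro ε hε
  set g : C(𝕋, ℂ) := ⟨fun θ => G (fourier 1 θ), hG.comp (fourier 1).continuous⟩ with hg
  have hmem : g ∈ closure (Submodule.span ℂ (Set.range fun n : ℤ => (fourier n : C(𝕋, ℂ))) : Set _) := by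
    rw [← Submodule.topologicalClosure_coe, span_fourier_closure_eq_top]
    trivial
  obtain ⟨h, hh, hd⟩ := Metric.mem_closure_iff.1 hmem (ε / 4) (by linarith)
  obtain ⟨H, hH, eH, wH⟩ := exists_isWalkAverage_of_mem_span hh
  have hgh : ∀ θ, ‖g θ - h θ‖ < ε / 4 := fun θ => by
    rw [← dist_eq_norm]
    exact (ContinuousMap.dist_apply_le_dist θ).trans_lt hd
  obtain ⟨C, hC⟩ := exists_le_add_mul_one_sub_normSq (hG.sub hH) (ε := ε / 4) fun z hz => by
    obtain ⟨θ, rfl⟩ := exists_fourier_one_eq hz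
    rw [Pi.sub_apply, eH]
    exact hgh θ
  have hlim := (tendsto_integral_one_sub_normSq_diskWalk.const_mul C)
  rw [mul_zero] at hlim
  have ev1 := hlim.eventually_lt_const (show (0 : ℝ) < ε / 4 by linarith)
  have ev2 := (Metric.tendsto_nhds.1 wH) (ε / 4) (by linarith)
  obtain ⟨M, hM⟩ := eventually_atTop.1 (ev1.and ev2)
  refine ⟨M, fun m hm => ?_⟩
  obtain ⟨a1, a2⟩ := hM m hm.le
  have b1 : ‖∫ x, G (diskWalk m x).1 ∂unitMeasure - ∫ x, H (diskWalk m x).1 ∂unitMeasure‖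
      ≤ ε / 4 + C * ∫ x, (1 - ‖(diskWalk m x).1‖ ^ 2) ∂unitMeasure := by
    rw [← integral_sub (integrable_diskWalk m fun s => G s.1) (integrable_diskWalk m fun s => H s.1)]
    refine (norm_integral_le_of_norm_le
      (integrable_diskWalk m fun s => ε / 4 + C * (1 - ‖s.1‖ ^ 2))
      (ae_of_all _ fun x => hC _ (norm_diskWalk_fst_le m x))).trans_eq ?_
    rw [integral_add (integrable_const _) (integrable_diskWalk m fun s => C * (1 - ‖s.1‖ ^ 2)),
      integral_const_mul]
    simp
  have i : ∀ h : C(𝕋, ℂ), Integrable (fun θ => h θ) haarAddCircle := fun h =>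
    h.continuous.integrable_of_hasCompactSupport (HasCompactSupport.of_compactSpace _)
  have b2 : ‖∫ θ : 𝕋, H (fourier 1 θ) ∂haarAddCircle - ∫ θ : 𝕋, G (fourier 1 θ) ∂haarAddCircle‖
      ≤ ε / 4 := by
    simp only [eH]
    change ‖∫ θ, h θ ∂haarAddCircle - ∫ θ, g θ ∂haarAddCircle‖ ≤ ε / 4
    rw [← integral_sub (i h) (i g)]
    refine (norm_integral_le_of_norm_le_const (C := ε / 4)
      (ae_of_all _ fun θ => ?_)).trans_eq (by simp)
    rw [norm_sub_rev]
    exact (hgh θ).le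
  rw [dist_eq_norm] at a2 ⊢
  calc _ = ‖(∫ x, G (diskWalk m x).1 ∂unitMeasure - ∫ x, H (diskWalk m x).1 ∂unitMeasure)
        + (∫ x, H (diskWalk m x).1 ∂unitMeasure - ∫ θ : 𝕋, H (fourier 1 θ) ∂haarAddCircle)
        + (∫ θ : 𝕋, H (fourier 1 θ) ∂haarAddCircle - ∫ θ : 𝕋, G (fourier 1 θ) ∂haarAddCircle)‖ := by
        congr 1; ring
    _ < ε := by
      refine (norm_add₃_le).trans_lt ?_
      linarith

theorem tendsto_eLpNorm_diskWalk {E : Type*} [NormedAddCommGroup E] {u : ℂ → E}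
    (hu : Continuous u) {p : ℝ≥0∞} (hp0 : p ≠ 0) (hp : p ≠ ∞) :
    Tendsto (fun m => eLpNorm (fun x => u (diskWalk m x).1) p unitMeasure) atTop
      (𝓝 (eLpNorm (fun θ : 𝕋 => u (fourier 1 θ)) p haarAddCircle)) := by
  have hpos : 0 < p.toReal := ENNReal.toReal_pos hp0 hp
  have hc : Continuous fun θ : 𝕋 => u (fourier 1 θ) := hu.comp (fourier 1).continuous
  have hmem : MemLp (fun θ : 𝕋 => u (fourier 1 θ)) p haarAddCircle :=
    hc.memLp_of_hasCompactSupport (HasCompactSupport.of_compactSpace _)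
  rw [hmem.eLpNorm_eq_integral_rpow_norm hp0 hp]
  simp only [fun m => (memLp_diskWalk m (fun s => u s.1) p).eLpNorm_eq_integral_rpow_norm hp0 hp]
  refine ENNReal.tendsto_ofReal (Tendsto.rpow_const ?_ (Or.inr (by positivity)))
  have h := isWalkAverage_of_continuous (G := fun z => ((‖u z‖ ^ p.toReal : ℝ) : ℂ))
    (Complex.continuous_ofReal.comp (hu.norm.rpow_const fun _ => Or.inr hpos.le))
  unfold IsWalkAverage at h
  simp only [integral_complex_ofReal] at h
  exact_mod_cast (Complex.continuous_re.tendsto _).comp h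

end Equidistribution

/-! ### Transfer of the bound to trigonometric polynomials -/

section Transfer

open AddCircle

local notation "𝕋" => AddCircle (2 * Real.pi)

variable {X : Type*} [NormedAddCommGroup X]

theorem memLp_of_continuous_addCircle {f : 𝕋 → X} (hf : Continuous f) (p : ℝ≥0∞) :
    MemLp f p volume :=
  hf.memLp_of_hasCompactSupport (HasCompactSupport.of_compactSpace _)

theorem integrable_of_continuous_addCircle {f : 𝕋 → X} (hf : Continuous f) :
    Integrable f volume :=
  hf.integrable_of_hasCompactSupport (HasCompactSupport.of_compactSpace _)

variable [NormedSpace ℝ X]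

theorem continuous_fourier_re (n : ℤ) : Continuous fun θ : 𝕋 => (fourier n θ : ℂ).re :=
  Complex.continuous_re.comp (fourier n).continuous

theorem continuous_fourier_im (n : ℤ) : Continuous fun θ : 𝕋 => (fourier n θ : ℂ).im :=
  Complex.continuous_im.comp (fourier n).continuous

theorem integral_smul_add_smul {φ : 𝕋 → ℝ} (hφ : Continuous φ) {f₁ f₂ : 𝕋 → X}
    (h₁ : Continuous f₁) (h₂ : Continuous f₂) (c : ℝ) :
    ∫ θ, φ θ • (f₁ θ + c • f₂ θ) = (∫ θ, φ θ • f₁ θ) + c • ∫ θ, φ θ • f₂ θ := by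
  rw [← integral_smul, ← integral_add (f := fun θ => φ θ • f₁ θ) (g := fun θ => c • φ θ • f₂ θ)
    (integrable_of_continuous_addCircle (hφ.smul h₁))
    (integrable_of_continuous_addCircle ((hφ.smul h₂).const_smul c))]
  simp only [smul_add, smul_comm c]

theorem IsHilbertTransform.add_smul {f₁ f₂ g₁ g₂ : 𝕋 → X} (h₁ : IsHilbertTransform f₁ g₁)
    (h₂ : IsHilbertTransform f₂ g₂) (cf₁ : Continuous f₁) (cf₂ : Continuous f₂)
    (cg₁ : Continuous g₁) (cg₂ : Continuous g₂) (c : ℝ) :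
    IsHilbertTransform (fun θ => f₁ θ + c • f₂ θ) (fun θ => g₁ θ + c • g₂ θ) := by
  refine ⟨?_, fun n hn => ⟨?_, ?_⟩⟩
  · have := integral_smul_add_smul (φ := fun _ => 1) continuous_const cg₁ cg₂ c
    simpa [h₁.1, h₂.1] using this
  · rw [integral_smul_add_smul (continuous_fourier_re n) cg₁ cg₂,
      integral_smul_add_smul (continuous_fourier_im n) cf₁ cf₂, (h₁.2 n hn).1, (h₂.2 n hn).1,
      smul_neg, neg_add]
  · rw [integral_smul_add_smul (continuous_fourier_im n) cg₁ cg₂,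
      integral_smul_add_smul (continuous_fourier_re n) cf₁ cf₂, (h₁.2 n hn).2, (h₂.2 n hn).2]

theorem integral_re_mul_fourier_pow (b : ℂ) {j : ℕ} (hj : j ≠ 0) :
    ∫ θ : 𝕋, (b * (fourier 1 θ : ℂ) ^ j).re = 0 := by
  have hc : Continuous fun θ : 𝕋 => b * (fourier 1 θ : ℂ) ^ j :=
    ((fourier 1).continuous.pow j).const_mul b
  have h := Complex.reCLM.integral_comp_comm (integrable_of_continuous_addCircle hc)
  simp only [Complex.reCLM_apply] at h
  rw [h, integral_const_mul, volume_eq_smul_haarAddCircle, integral_smul_measure,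
    integral_fourier_one_pow, zero_pow hj]
  simp

/-- Multiplying by `z ^ k` on the circle, the two sides of each Fourier identity combine into the
real part of a multiple of `z ^ (k + n)`, plus a multiple of `z ^ k` from the subtracted constant.
Both have mean zero as `k ≥ 1`, so no case distinction between `k` and `n` is needed. -/
theorem isHilbertTransform_re_mul_pow [CompleteSpace X] (a : ℂ) (n : ℕ) (y : X) :
    IsHilbertTransform (fun θ => (a * (fourier 1 θ : ℂ) ^ n).re • y)
      (fun θ => (a * (-Complex.I * ((fourier 1 θ : ℂ) ^ n - 0 ^ n))).re • y) := by
  have cp : ∀ (b : ℂ) (j : ℕ), Continuous fun θ : 𝕋 => (b * (fourier 1 θ : ℂ) ^ j).re :=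
    fun b j => Complex.continuous_re.comp (((fourier 1).continuous.pow j).const_mul b)
  have cf : Continuous fun θ : 𝕋 => (a * (fourier 1 θ : ℂ) ^ n).re • y :=
    (cp a n).smul continuous_const
  have cg : Continuous fun θ : 𝕋 =>
      (a * (-Complex.I * ((fourier 1 θ : ℂ) ^ n - 0 ^ n))).re • y :=
    (Complex.continuous_re.comp (((((fourier 1).continuous.pow n).sub
      continuous_const).const_mul _).const_mul a)).smul continuous_const
  have i0 : ∀ (b c : ℂ) {j k : ℕ}, j ≠ 0 → k ≠ 0 →
      ∫ θ : 𝕋, ((b * (fourier 1 θ : ℂ) ^ j).re + (c * (fourier 1 θ : ℂ) ^ k).re) = 0 := by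
    intro b c j k hj hk
    rw [integral_add (integrable_of_continuous_addCircle (cp b j))
      (integrable_of_continuous_addCircle (cp c k)), integral_re_mul_fourier_pow b hj,
      integral_re_mul_fourier_pow c hk, add_zero]
  set r : ℝ := (a * (-Complex.I * 0 ^ n)).re with hr
  refine ⟨?_, fun k hk => ?_⟩
  · rw [integral_smul_const]
    rcases eq_or_ne n 0 with rfl | hn
    · simp
    · have h := integral_re_mul_fourier_pow (a * -Complex.I) hn
      simp only [mul_assoc] at h
      simp only [zero_pow hn, sub_zero, h, zero_smul]
  have hk0 : k ≠ 0 := by omega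
  have hkn : k + n ≠ 0 := by omega
  constructor
  · rw [eq_neg_iff_add_eq_zero, ← integral_add (f := fun θ : 𝕋 => (fourier (k : ℤ) θ : ℂ).re •
        (a * (-Complex.I * ((fourier 1 θ : ℂ) ^ n - 0 ^ n))).re • y)
      (g := fun θ : 𝕋 => (fourier (k : ℤ) θ : ℂ).im • (a * (fourier 1 θ : ℂ) ^ n).re • y)
      (integrable_of_continuous_addCircle ((continuous_fourier_re k).smul cg))
      (integrable_of_continuous_addCircle ((continuous_fourier_im k).smul cf))]
    simp only [smul_smul, ← _root_.add_smul]
    rw [integral_smul_const]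
    have := i0 (a * -Complex.I) (-r : ℝ) hkn hk0
    rw [← zero_smul ℝ y, ← this]
    congr 2
    funext θ
    simp only [fourier_natCast, mul_sub, Complex.sub_re, ← hr, Complex.re_ofReal_mul, pow_add]
    simp only [Complex.mul_re, Complex.mul_im, Complex.neg_re, Complex.neg_im, Complex.I_re,
      Complex.I_im]
    ring
  · rw [← sub_eq_zero, ← integral_sub (f := fun θ : 𝕋 => (fourier (k : ℤ) θ : ℂ).im •
        (a * (-Complex.I * ((fourier 1 θ : ℂ) ^ n - 0 ^ n))).re • y)
      (g := fun θ : 𝕋 => (fourier (k : ℤ) θ : ℂ).re • (a * (fourier 1 θ : ℂ) ^ n).re • y)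
      (integrable_of_continuous_addCircle ((continuous_fourier_im k).smul cg))
      (integrable_of_continuous_addCircle ((continuous_fourier_re k).smul cf))]
    simp only [smul_smul, ← _root_.sub_smul]
    rw [integral_smul_const]
    have := i0 (-a) (r * Complex.I) hkn hk0
    rw [← zero_smul ℝ y, ← this]
    congr 2
    funext θ
    simp only [fourier_natCast, mul_sub, Complex.sub_re, ← hr, mul_assoc, Complex.re_ofReal_mul,
      pow_add]
    simp only [Complex.mul_re, Complex.mul_im, Complex.neg_re, Complex.neg_im, Complex.I_re,
      Complex.I_im]
    ring

/-- `g` is the Hilbert transform of the continuous function `f`, and along the walks in the disc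
the pair `(f, g)` is modelled asymptotically in `L^p` by pairs of functions on `[0, 1)` with finite
Haar expansions that are related by the dyadic Hilbert transform. -/
def IsModelled (p : ℝ≥0∞) (f g : 𝕋 → X) : Prop :=
  IsHilbertTransform f g ∧ ∃ u v : ℂ → X, Continuous u ∧ Continuous v ∧
    (f = fun θ => u (fourier 1 θ)) ∧ (g = fun θ => v (fourier 1 θ)) ∧
    ∃ A B : ℕ → ℝ → X, (∀ m, MemLp (A m) p unitMeasure) ∧ (∀ m, MemLp (B m) p unitMeasure) ∧
      (∀ m, ∀ᶠ n in atTop, ∀ x ∈ Set.Ico (0 : ℝ) 1, dyadicHilbertPartial n (A m) x = B m x) ∧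
      Tendsto (fun m => eLpNorm (fun x => A m x - u (diskWalk m x).1) p unitMeasure) atTop (𝓝 0) ∧
      Tendsto (fun m => eLpNorm (fun x => B m x - v (diskWalk m x).1) p unitMeasure) atTop (𝓝 0)

theorem IsModelled.continuous_left {p : ℝ≥0∞} {f g : 𝕋 → X} (h : IsModelled p f g) :
    Continuous f := by
  obtain ⟨-, u, v, cu, -, rfl, -⟩ := h
  exact cu.comp (fourier 1).continuous

theorem IsModelled.continuous_right {p : ℝ≥0∞} {f g : 𝕋 → X} (h : IsModelled p f g) :
    Continuous g := by
  obtain ⟨-, u, v, -, cv, -, rfl, -⟩ := h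
  exact cv.comp (fourier 1).continuous

theorem tendsto_eLpNorm_add_smul {p : ℝ≥0∞} (hp : 1 ≤ p) {D₁ D₂ : ℕ → ℝ → X}
    (m₁ : ∀ m, MemLp (D₁ m) p unitMeasure) (m₂ : ∀ m, MemLp (D₂ m) p unitMeasure)
    (t₁ : Tendsto (fun m => eLpNorm (D₁ m) p unitMeasure) atTop (𝓝 0))
    (t₂ : Tendsto (fun m => eLpNorm (D₂ m) p unitMeasure) atTop (𝓝 0)) (c : ℝ) :
    Tendsto (fun m => eLpNorm (D₁ m + c • D₂ m) p unitMeasure) atTop (𝓝 0) := by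
  have ht : Tendsto (fun m => eLpNorm (D₁ m) p unitMeasure + ‖c‖ₑ * eLpNorm (D₂ m) p unitMeasure)
      atTop (𝓝 0) := by
    simpa using t₁.add (ENNReal.Tendsto.const_mul t₂ (Or.inr (enorm_ne_top (x := c))))
  refine tendsto_of_tendsto_of_tendsto_of_le_of_le tendsto_const_nhds ht (fun _ => zero_le)
    fun m => ?_
  refine (eLpNorm_add_le (m₁ m).aestronglyMeasurable
    ((m₂ m).const_smul c).aestronglyMeasurable hp).trans ?_
  rw [eLpNorm_const_smul]

theorem IsModelled.add_smul {p : ℝ≥0∞} (hp : 1 ≤ p) {f₁ f₂ g₁ g₂ : 𝕋 → X}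
    (h₁ : IsModelled p f₁ g₁) (h₂ : IsModelled p f₂ g₂) (c : ℝ) :
    IsModelled p (fun θ => f₁ θ + c • f₂ θ) (fun θ => g₁ θ + c • g₂ θ) := by
  refine ⟨h₁.1.add_smul h₂.1 h₁.continuous_left h₂.continuous_left h₁.continuous_right
    h₂.continuous_right c, ?_⟩
  obtain ⟨-, u₁, v₁, cu₁, cv₁, rfl, rfl, A₁, B₁, mA₁, mB₁, e₁, tA₁, tB₁⟩ := h₁
  obtain ⟨-, u₂, v₂, cu₂, cv₂, rfl, rfl, A₂, B₂, mA₂, mB₂, e₂, tA₂, tB₂⟩ := h₂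
  refine ⟨fun z => u₁ z + c • u₂ z, fun z => v₁ z + c • v₂ z, cu₁.add (cu₂.const_smul c),
    cv₁.add (cv₂.const_smul c), rfl, rfl, fun m x => A₁ m x + c • A₂ m x,
    fun m x => B₁ m x + c • B₂ m x, fun m => (mA₁ m).add ((mA₂ m).const_smul c),
    fun m => (mB₁ m).add ((mB₂ m).const_smul c), fun m => ?_, ?_, ?_⟩
  · filter_upwards [e₁ m, e₂ m] with n h₁ h₂ x hx
    rw [dyadicHilbertPartial_add_smul ((mA₁ m).integrable hp) ((mA₂ m).integrable hp), h₁ x hx,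
      h₂ x hx]
  · refine (tendsto_eLpNorm_add_smul hp
      (fun m => (mA₁ m).sub (memLp_diskWalk m (fun s => u₁ s.1) p))
      (fun m => (mA₂ m).sub (memLp_diskWalk m (fun s => u₂ s.1) p)) tA₁ tA₂ c).congr fun m => ?_
    congr 1
    funext x
    simp only [Pi.add_apply, Pi.smul_apply, Pi.sub_apply, smul_sub]
    abel
  · refine (tendsto_eLpNorm_add_smul hp
      (fun m => (mB₁ m).sub (memLp_diskWalk m (fun s => v₁ s.1) p))
      (fun m => (mB₂ m).sub (memLp_diskWalk m (fun s => v₂ s.1) p)) tB₁ tB₂ c).congr fun m => ?_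
    congr 1
    funext x
    simp only [Pi.add_apply, Pi.smul_apply, Pi.sub_apply, smul_sub]
    abel

omit [NormedSpace ℝ X] in
theorem tendsto_eLpNorm_of_norm_le_mul {p : ℝ≥0∞} (hp' : p ≠ ∞) (n : ℕ) {D : ℕ → ℝ → X} (c : ℝ)
    (h : ∀ m x, ‖D m x‖ ≤ c * ‖(diskWalk m x).1 ^ n - (diskWalk m x).2 n‖) :
    Tendsto (fun m => eLpNorm (D m) p unitMeasure) atTop (𝓝 0) := by
  have ht := ENNReal.Tendsto.const_mul (tendsto_eLpNorm_diskWalk_sub n hp')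
    (Or.inr (ENNReal.ofReal_ne_top (r := c)))
  rw [mul_zero] at ht
  exact tendsto_of_tendsto_of_tendsto_of_le_of_le tendsto_const_nhds ht (fun _ => zero_le)
    fun m => eLpNorm_le_mul_eLpNorm_of_ae_le_mul (ae_of_all _ (h m)) p

/-- The models are the images of the martingale for `z ^ n`, and of its transform, under the real
linear map `w ↦ Re (a w) y`. The subtracted `0 ^ n` makes both transforms kill constants when `n =
0`. -/
theorem isModelled_re_mul_pow [CompleteSpace X] {p : ℝ≥0∞} (hp' : p ≠ ∞) (a : ℂ) (n : ℕ) (y : X) :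
    IsModelled p (fun θ => (a * (fourier 1 θ : ℂ) ^ n).re • y)
      (fun θ => (a * (-Complex.I * ((fourier 1 θ : ℂ) ^ n - 0 ^ n))).re • y) := by
  let L : ℂ →L[ℝ] X := (Complex.reCLM.smulRight y).comp (ContinuousLinearMap.mul ℝ ℂ a)
  have hL : ∀ w, L w = (a * w).re • y := fun w => rfl
  refine ⟨isHilbertTransform_re_mul_pow a n y, fun z => L (z ^ n),
    fun z => L (-Complex.I * (z ^ n - 0 ^ n)), L.continuous.comp (by fun_prop),
    L.continuous.comp (by fun_prop), rfl, rfl, fun m x => L ((diskWalk m x).2 n),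
    fun m x => L (-Complex.I * ((diskWalk m x).2 n - 0 ^ n)),
    fun m => memLp_diskWalk m (fun s => L (s.2 n)) p,
    fun m => memLp_diskWalk m (fun s => L (-Complex.I * (s.2 n - 0 ^ n))) p, fun m => ?_, ?_, ?_⟩
  · filter_upwards [eventually_ge_atTop (2 * (m + 1) ^ 5)] with k hk x hx
    rw [dyadicHilbertPartial_clm_comp (integrable_diskWalk m fun s => s.2 n)]
    exact congrArg L (dyadicHilbertPartial_walk_snd _ _ _ n hk hx)
  · refine tendsto_eLpNorm_of_norm_le_mul hp' n ‖L‖ fun m x => ?_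
    rw [← map_sub, norm_sub_rev ((diskWalk m x).1 ^ n)]
    exact L.le_opNorm _
  · refine tendsto_eLpNorm_of_norm_le_mul hp' n ‖L‖ fun m x => ?_
    rw [← map_sub]
    refine (L.le_opNorm _).trans_eq ?_
    rw [← mul_sub, norm_mul, norm_neg, Complex.norm_I, one_mul, sub_sub_sub_cancel_right,
      norm_sub_rev]

/-- A complex `a` is carried through the induction to absorb complex scalars. Negative frequencies
reduce to positive ones by conjugation under the real part. -/
theorem exists_isModelled_of_mem_span [CompleteSpace X] {p : ℝ≥0∞} (hp : 1 ≤ p) (hp' : p ≠ ∞)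
    {h : C(𝕋, ℂ)} (hh : h ∈ Submodule.span ℂ (Set.range fun n : ℤ => (fourier n : C(𝕋, ℂ))))
    (a : ℂ) (y : X) : ∃ g, IsModelled p (fun θ => (a * h θ).re • y) g := by
  induction hh using Submodule.span_induction generalizing a with
  | mem h hh =>
    obtain ⟨n, rfl⟩ := hh
    obtain ⟨k, rfl | rfl⟩ := n.eq_nat_or_neg
    · simp only [fourier_natCast]
      exact ⟨_, isModelled_re_mul_pow hp' a k y⟩
    · have e : ∀ θ : 𝕋, (a * fourier (-(k : ℤ)) θ).re
          = ((starRingEnd ℂ) a * (fourier 1 θ : ℂ) ^ k).re := by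
        intro θ
        rw [fourier_neg, fourier_natCast, ← Complex.conj_re, map_mul, Complex.conj_conj]
      simp only [e]
      exact ⟨_, isModelled_re_mul_pow hp' _ k y⟩
  | zero =>
    have := isModelled_re_mul_pow hp' 0 0 y
    simp only [ContinuousMap.zero_apply, mul_zero]
    simp only [zero_mul] at this
    exact ⟨_, this⟩
  | add h₁ h₂ _ _ ih₁ ih₂ =>
    obtain ⟨g₁, H₁⟩ := ih₁ a
    obtain ⟨g₂, H₂⟩ := ih₂ a
    have := H₁.add_smul hp H₂ 1
    simp only [one_smul, ← _root_.add_smul, ← Complex.add_re, ← mul_add] at this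
    exact ⟨_, this⟩
  | smul b h _ ih =>
    obtain ⟨g, H⟩ := ih (a * b)
    refine ⟨g, ?_⟩
    simpa only [ContinuousMap.smul_apply, smul_eq_mul, mul_assoc] using H

/-! ### Density of trigonometric polynomials and passage to the limit -/

theorem exists_mem_span_eLpNorm_sub_lt {p : ℝ≥0∞} (hp : 1 ≤ p) (hp' : p ≠ ∞) {f : 𝕋 → ℂ}
    (hf : MemLp f p volume) {ε : ℝ≥0∞} (hε : ε ≠ 0) :
    ∃ h ∈ Submodule.span ℂ (Set.range fun n : ℤ => (fourier n : C(𝕋, ℂ))),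
      eLpNorm (fun θ => f θ - h θ) p volume < ε := by
  have : Fact (1 ≤ p) := ⟨hp⟩
  have hd : Dense ((Submodule.span ℂ (Set.range fun n : ℤ => (fourier n : C(𝕋, ℂ)))) : Set C(𝕋, ℂ)) :=
    (Submodule.dense_iff_topologicalClosure_eq_top).2 span_fourier_closure_eq_top
  have hd' := (ContinuousMap.toLp_denseRange ℂ (volume : Measure 𝕋) ℂ hp').dense_image
    (ContinuousMap.toLp p (volume : Measure 𝕋) ℂ).continuous hd
  obtain ⟨_, ⟨h, hh, rfl⟩, hlt⟩ := EMetric.mem_closure_iff.1 (hd' (hf.toLp f)) ε (pos_iff_ne_zero.2 hε)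
  refine ⟨h, hh, ?_⟩
  rw [Lp.edist_def] at hlt
  refine lt_of_eq_of_lt (eLpNorm_congr_ae ?_) hlt
  filter_upwards [hf.coeFn_toLp, ContinuousMap.coeFn_toLp (p := p) (𝕜 := ℂ) volume h] with θ h1 h2
  rw [Pi.sub_apply, h1, h2]

theorem exists_isModelled_eLpNorm_sub_le [CompleteSpace X] {p : ℝ≥0∞} (hp : 1 ≤ p) (hp' : p ≠ ∞)
    {f : 𝕋 → X} (hf : MemLp f p volume) {ε : ℝ≥0∞} (hε : ε ≠ 0) :
    ∃ f' : 𝕋 → X, eLpNorm (f - f') p volume ≤ ε ∧ ∃ g, IsModelled p f' g := by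
  refine MemLp.induction_dense hp' _ (fun c s hs hμ ε hε => ?_) (fun f₁ f₂ h₁ h₂ => ?_)
    (fun f h => ?_) hf hε
  · have hc : ‖c‖ₑ + 1 ≠ ∞ := ENNReal.add_ne_top.2 ⟨enorm_ne_top, ENNReal.one_ne_top⟩
    have hε' : ε / (‖c‖ₑ + 1) ≠ 0 := ENNReal.div_ne_zero.2 ⟨hε, hc⟩
    obtain ⟨h, hh, hlt⟩ := exists_mem_span_eLpNorm_sub_lt hp hp'
      (memLp_indicator_const p hs (1 : ℂ) (Or.inr hμ.ne)) hε'
    obtain ⟨g, hg⟩ := exists_isModelled_of_mem_span hp hp' hh 1 c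
    refine ⟨_, ?_, g, hg⟩
    have hle : ∀ θ, ‖((fun θ => (1 * h θ).re • c) - s.indicator fun _ => c) θ‖
        ≤ ‖c‖ * ‖s.indicator (fun _ => (1 : ℂ)) θ - h θ‖ := by
      intro θ
      have e : ((fun θ => (1 * h θ).re • c) - s.indicator fun _ => c) θ
          = (h θ - s.indicator (fun _ => (1 : ℂ)) θ).re • c := by
        by_cases hθ : θ ∈ s <;> simp [hθ, sub_smul]
      rw [e, norm_smul, mul_comm, norm_sub_rev]
      gcongr
      exact Complex.abs_re_le_norm _
    refine (eLpNorm_le_mul_eLpNorm_of_ae_le_mul (ae_of_all _ hle) p).trans ?_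
    rw [ofReal_norm]
    calc _ ≤ (‖c‖ₑ + 1) * (ε / (‖c‖ₑ + 1)) := by gcongr; exact le_self_add
      _ = ε := ENNReal.mul_div_cancel (by simp) hc
  · obtain ⟨g₁, H₁⟩ := h₁
    obtain ⟨g₂, H₂⟩ := h₂
    have := H₁.add_smul hp H₂ 1
    simp only [one_smul] at this
    exact ⟨_, this⟩
  · obtain ⟨g, hg⟩ := h
    exact hg.continuous_left.aestronglyMeasurable

/-- The partial sums are eventually equal to `B`, so the transform supplied by `hC` is `B` almost
everywhere, by uniqueness of limits. -/
theorem eLpNorm_le_of_dyadicHilbert_bounded {p : ℝ≥0∞} (hp : 1 ≤ p) {C : ℝ≥0}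
    (hC : ∀ f : ℝ → X, MemLp f p unitMeasure → ∃ g : ℝ → X, MemLp g p unitMeasure ∧
      IsDyadicHilbertTransform p f g ∧ eLpNorm g p unitMeasure ≤ C * eLpNorm f p unitMeasure)
    {A B : ℝ → X} (hA : MemLp A p unitMeasure) (hB : MemLp B p unitMeasure)
    (h : ∀ᶠ n in atTop, ∀ x ∈ Set.Ico (0 : ℝ) 1, dyadicHilbertPartial n A x = B x) :
    eLpNorm B p unitMeasure ≤ C * eLpNorm A p unitMeasure := by
  obtain ⟨g, hg, ht, hle⟩ := hC A hA
  have hp0 : p ≠ 0 := (zero_lt_one.trans_le hp).ne'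
  have h0 : eLpNorm (fun x => g x - B x) p unitMeasure = 0 := by
    refine tendsto_nhds_unique ((tendsto_congr' ?_).1 ht) tendsto_const_nhds |>.symm
    filter_upwards [h] with n hn
    refine eLpNorm_congr_ae ((ae_restrict_iff' measurableSet_Ico).2 (ae_of_all _ fun x hx => ?_))
    simp only [hn x hx]
  have hae : g =ᵐ[unitMeasure] B := by
    filter_upwards [(eLpNorm_eq_zero_iff (hg.sub hB).aestronglyMeasurable hp0).1 h0] with x hx
    exact sub_eq_zero.1 hx
  rwa [← eLpNorm_congr_ae hae]

theorem IsModelled.eLpNorm_le {p : ℝ≥0∞} (hp : 1 ≤ p) (hp' : p ≠ ∞) {C : ℝ≥0}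
    (hC : ∀ f : ℝ → X, MemLp f p unitMeasure → ∃ g : ℝ → X, MemLp g p unitMeasure ∧
      IsDyadicHilbertTransform p f g ∧ eLpNorm g p unitMeasure ≤ C * eLpNorm f p unitMeasure)
    {f g : 𝕋 → X} (h : IsModelled p f g) :
    eLpNorm g p volume ≤ C * eLpNorm f p volume := by
  have hp0 : p ≠ 0 := (zero_lt_one.trans_le hp).ne'
  obtain ⟨-, u, v, cu, cv, rfl, rfl, A, B, mA, mB, e, tA, tB⟩ := h
  have tu := tendsto_eLpNorm_diskWalk cu hp0 hp'
  have tv := tendsto_eLpNorm_diskWalk cv hp0 hp'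
  have key : ∀ m, eLpNorm (fun x => v (diskWalk m x).1) p unitMeasure
      ≤ C * (eLpNorm (fun x => A m x - u (diskWalk m x).1) p unitMeasure
        + eLpNorm (fun x => u (diskWalk m x).1) p unitMeasure)
        + eLpNorm (fun x => B m x - v (diskWalk m x).1) p unitMeasure := by
    intro m
    have mu := memLp_diskWalk m (fun s => u s.1) p
    have mv := memLp_diskWalk m (fun s => v s.1) p
    have h1 := eLpNorm_sub_le (mB m).aestronglyMeasurable
      ((mB m).sub mv).aestronglyMeasurable hp
    have h2 := eLpNorm_add_le ((mA m).sub mu).aestronglyMeasurable mu.aestronglyMeasurable hp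
    rw [sub_sub_cancel] at h1
    rw [sub_add_cancel] at h2
    refine h1.trans (add_le_add ?_ le_rfl)
    exact (eLpNorm_le_of_dyadicHilbert_bounded hp hC (mA m) (mB m) (e m)).trans
      (mul_le_mul_right h2 _)
  have lim := (ENNReal.Tendsto.const_mul (tA.add tu) (Or.inr (ENNReal.coe_ne_top (r := C)))).add tB
  rw [zero_add, add_zero] at lim
  have main := le_of_tendsto_of_tendsto' tv lim key
  -- The walk yields normalised Haar measure; passing to arc length multiplies both norms by the
  -- same factor.
  rw [volume_eq_smul_haarAddCircle, eLpNorm_smul_measure_of_ne_top hp',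
    eLpNorm_smul_measure_of_ne_top hp', smul_eq_mul, smul_eq_mul, mul_left_comm]
  gcongr

theorem tendsto_integral_smul_of_eLpNorm {p : ℝ≥0∞} (hp : 1 ≤ p) {φ : 𝕋 → ℝ} (hφ : Continuous φ)
    (hφ1 : ∀ θ, |φ θ| ≤ 1) {f : 𝕋 → X} {F : ℕ → 𝕋 → X} (hf : MemLp f p volume)
    (hF : ∀ k, MemLp (F k) p volume)
    (h : Tendsto (fun k => eLpNorm (F k - f) p volume) atTop (𝓝 0)) :
    Tendsto (fun k => ∫ θ, φ θ • F k θ) atTop (𝓝 (∫ θ, φ θ • f θ)) := by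
  have hint : ∀ {f : 𝕋 → X}, MemLp f p volume → Integrable (fun θ => φ θ • f θ) volume :=
    fun {f} hf => (hf.integrable hp).bdd_smul 1 hφ.aestronglyMeasurable (ae_of_all _ hφ1)
  refine tendsto_integral_of_L1' _ (hint hf).aestronglyMeasurable (Eventually.of_forall fun k => hint (hF k)) ?_
  have hc : (volume : Measure 𝕋) Set.univ ^ (1 / (1 : ℝ≥0∞).toReal - 1 / p.toReal) ≠ ∞ := by
    refine ENNReal.rpow_ne_top_of_nonneg ?_ (measure_ne_top _ _)
    rcases eq_or_ne p ∞ with rfl | hp'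
    · simp
    · have : 1 ≤ p.toReal := by simpa using ENNReal.toReal_mono hp' hp
      simpa using inv_le_one_of_one_le₀ this
  have ht := ENNReal.Tendsto.mul_const h (Or.inr hc)
  rw [zero_mul] at ht
  refine tendsto_of_tendsto_of_tendsto_of_le_of_le tendsto_const_nhds ht (fun _ => zero_le)
    fun k => ?_
  refine (eLpNorm_mono fun θ => ?_).trans
    (eLpNorm_le_eLpNorm_mul_rpow_measure_univ hp ((hF k).sub hf).aestronglyMeasurable)
  rw [Pi.sub_apply, Pi.sub_apply, ← smul_sub, norm_smul]
  exact mul_le_of_le_one_left (norm_nonneg _) (hφ1 θ)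

/-- Fourier coefficients are continuous in `L^p`, because the circle has finite measure, so the
graph of the transform is closed. -/
theorem isHilbertTransform_of_tendsto {p : ℝ≥0∞} (hp : 1 ≤ p) {f g : 𝕋 → X} {F G : ℕ → 𝕋 → X}
    (hf : MemLp f p volume) (hg : MemLp g p volume) (hF : ∀ k, MemLp (F k) p volume)
    (hG : ∀ k, MemLp (G k) p volume) (h : ∀ k, IsHilbertTransform (F k) (G k))
    (tF : Tendsto (fun k => eLpNorm (F k - f) p volume) atTop (𝓝 0))
    (tG : Tendsto (fun k => eLpNorm (G k - g) p volume) atTop (𝓝 0)) :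
    IsHilbertTransform f g := by
  have bre : ∀ (n : ℤ) (θ : 𝕋), |(fourier n θ : ℂ).re| ≤ 1 := fun n θ =>
    (Complex.abs_re_le_norm _).trans (by rw [fourier_apply, Circle.norm_coe])
  have bim : ∀ (n : ℤ) (θ : 𝕋), |(fourier n θ : ℂ).im| ≤ 1 := fun n θ =>
    (Complex.abs_im_le_norm _).trans (by rw [fourier_apply, Circle.norm_coe])
  refine ⟨?_, fun n hn => ⟨?_, ?_⟩⟩
  · have := tendsto_integral_smul_of_eLpNorm hp (φ := fun _ => 1) continuous_const (by simp) hg hG tG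
    simp only [one_smul, (h _).1] at this
    exact tendsto_nhds_unique this tendsto_const_nhds
  · have t₁ := tendsto_integral_smul_of_eLpNorm hp (continuous_fourier_re n) (bre n) hg hG tG
    have t₂ := tendsto_integral_smul_of_eLpNorm hp (continuous_fourier_im n) (bim n) hf hF tF
    simp only [((h _).2 n hn).1] at t₁
    exact tendsto_nhds_unique t₁ t₂.neg
  · have t₁ := tendsto_integral_smul_of_eLpNorm hp (continuous_fourier_im n) (bim n) hg hG tG
    have t₂ := tendsto_integral_smul_of_eLpNorm hp (continuous_fourier_re n) (bre n) hf hF tF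
    simp only [((h _).2 n hn).2] at t₁
    exact tendsto_nhds_unique t₁ t₂

theorem exists_isHilbertTransform_of_dyadicHilbert_bounded [CompleteSpace X] {p : ℝ≥0∞}
    (hp : 1 ≤ p) (hp' : p ≠ ∞) {C : ℝ≥0}
    (hC : ∀ f : ℝ → X, MemLp f p unitMeasure → ∃ g : ℝ → X, MemLp g p unitMeasure ∧
      IsDyadicHilbertTransform p f g ∧ eLpNorm g p unitMeasure ≤ C * eLpNorm f p unitMeasure)
    {f : 𝕋 → X} (hf : MemLp f p volume) :
    ∃ g : 𝕋 → X, MemLp g p volume ∧ IsHilbertTransform f g ∧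
      eLpNorm g p volume ≤ C * eLpNorm f p volume := by
  have : Fact (1 ≤ p) := ⟨hp⟩
  have hex : ∀ k : ℕ, ∃ f' : 𝕋 → X, eLpNorm (f - f') p volume ≤ (k : ℝ≥0∞)⁻¹ ∧
      ∃ g, IsModelled p f' g := fun k =>
    exists_isModelled_eLpNorm_sub_le hp hp' hf (ENNReal.inv_ne_zero.2 (ENNReal.natCast_ne_top k))
  choose F hF G hFG using hex
  have mF : ∀ k, MemLp (F k) p volume := fun k =>
    memLp_of_continuous_addCircle (hFG k).continuous_left p
  have mG : ∀ k, MemLp (G k) p volume := fun k =>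
    memLp_of_continuous_addCircle (hFG k).continuous_right p
  have tF : Tendsto (fun k => eLpNorm (F k - f) p volume) atTop (𝓝 0) := by
    simp only [eLpNorm_sub_comm (F _) f]
    exact tendsto_of_tendsto_of_tendsto_of_le_of_le tendsto_const_nhds
      ENNReal.tendsto_inv_nat_nhds_zero (fun _ => zero_le) hF
  have hle : ∀ k l, dist ((mG k).toLp (G k)) ((mG l).toLp (G l))
      ≤ C * dist ((mF k).toLp (F k)) ((mF l).toLp (F l)) := by
    intro k l
    suffices h : edist ((mG k).toLp (G k)) ((mG l).toLp (G l))
        ≤ C * edist ((mF k).toLp (F k)) ((mF l).toLp (F l)) by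
      rw [edist_nndist, edist_nndist] at h
      exact_mod_cast h
    rw [Lp.edist_toLp_toLp, Lp.edist_toLp_toLp]
    -- The pairs are stable under differences, so the bound makes the transforms a Cauchy sequence.
    have := ((hFG k).add_smul hp (hFG l) (-1)).eLpNorm_le hp hp' hC
    simp only [neg_smul, one_smul, ← sub_eq_add_neg] at this
    exact this
  have limF : Tendsto (fun k => (mF k).toLp (F k)) atTop (𝓝 (hf.toLp f)) :=
    (Lp.tendsto_Lp_iff_tendsto_eLpNorm'' F mF f hf).2 tF
  have cauchyG : CauchySeq fun k => (mG k).toLp (G k) := by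
    have cF := limF.cauchySeq
    rw [cauchySeq_iff_tendsto, tendsto_uniformity_iff_dist_tendsto_zero] at cF ⊢
    have ht := cF.const_mul (C : ℝ)
    rw [mul_zero] at ht
    exact squeeze_zero (fun _ => dist_nonneg) (fun q => hle q.1 q.2) ht
  obtain ⟨g, hg⟩ := cauchySeq_tendsto_of_complete cauchyG
  have tG : Tendsto (fun k => eLpNorm (G k - (g : 𝕋 → X)) p volume) atTop (𝓝 0) := by
    have : Tendsto (fun k => (mG k).toLp (G k)) atTop (𝓝 ((Lp.memLp g).toLp g)) := by
      rwa [Lp.toLp_coeFn]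
    exact (Lp.tendsto_Lp_iff_tendsto_eLpNorm'' G mG g (Lp.memLp g)).1 this
  refine ⟨g, Lp.memLp g, isHilbertTransform_of_tendsto hp hf (Lp.memLp g) mF mG
    (fun k => (hFG k).1) tF tG, ?_⟩
  have n₁ := (continuous_enorm.tendsto g).comp hg
  have n₂ := ENNReal.Tendsto.const_mul ((continuous_enorm.tendsto (hf.toLp f)).comp limF)
    (Or.inr (ENNReal.coe_ne_top (r := C)))
  have := le_of_tendsto_of_tendsto' n₁ n₂ fun k => by
    simp only [Function.comp_apply, Lp.enorm_toLp]
    exact (hFG k).eLpNorm_le hp hp' hC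
  rwa [Lp.enorm_def, Lp.enorm_toLp] at this

end Transfer

theorem theorem1 (X : Type*) [NormedAddCommGroup X] [NormedSpace ℝ X] [CompleteSpace X]
    (p : ℝ≥0∞) (hp : 1 < p) (hp' : p < ∞) :
    hilbertNorm X p ≤ dyadicHilbertNorm X p := by
  refine le_iInf₂ fun C hC => iInf₂_le C fun f hf => ?_
  exact exists_isHilbertTransform_of_dyadicHilbert_bounded hp.le hp'.ne hC hf
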